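/- **Definitions.** A *process template* $P$ (direction-unaware) consists of a finite state set $Q$ with a set $T\subseteq Q$ of states that "have the token", initial states $\iota_t\in T$ and $\iota_n\in Q\setminus T$, a finite non-empty set $\Sigma_{int}$ of internal labels, a transition relation $\delta\subseteq Q\times(\Sigma_{int}\sqcup\{snd,rcv\})\times Q$, and a labeling of each state by a finite set of atoms from a fixed countably infinite set $AP$, such that: $snd$-transitions lead from $T$ to $Q\setminus T$; $rcv$-transitions lead from $Q\setminus T$ to $T$; internal transitions preserve having and not having the token; every state has an outgoing transition; and on every infinite path (from any state) infinitely many actions are $snd$ or $rcv$, and these two alternate, i.e. the action sequence is in $(\Sigma_{int}^*\,snd\,\Sigma_{int}^*\,rcv)^\omega\cup(\Sigma_{int}^*\,rcv\,\Sigma_{int}^*\,snd)^\omega$. A *topology* $G=(V,E,x)$ is a finite directed graph without self-loops on $V=\{1,\dots,n\}$, $n\ge 1$, with an initial vertex $x\in V$. A *parameterized topology* is a (necessarily countable) set $\mathbf G$ of topologies, not assumed to be computable. The *token-passing system* $P^G$ has state set $Q^V$; its initial state has $\iota_t$ at $x$ and $\iota_n$ elsewhere; in a transition either exactly one process makes an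 internal transition, or for some edge $(v,w)\in E$ process $v$ makes a $snd$-transition and simultaneously process $w$ makes a $rcv$-transition, all other processes being unchanged; the atom $p_v$ holds in a state $s$ iff $p$ is in the label of $s(v)$. $\mathsf{CTL}^*\setminus\mathsf X$ has the state formulas $\varphi::=\top\mid a\mid\neg\varphi\mid\varphi\wedge\varphi\mid\mathsf E\psi$ and the path formulas $\psi::=\varphi\mid\neg\psi\mid\psi\wedge\psi\mid\psi\,\mathsf U\,\psi$, with the usual semantics and $\mathsf A=\neg\mathsf E\neg$. Path quantifiers range over one of the following, fixed throughout: (a) all infinite paths, or (b) all maximal paths, where a finite maximal path (one that ends in a deadlocked state) is read as repeating its last state forever. A *$k$-indexed prenex* formula is $Q_1x_1\dots Q_kx_k.\,\varphi$ with $\varphi$ a $\mathsf{CTL}^*\setminus\mathsf X$ state formula over the atoms $p_{x_j}$ ($p\in AP$, $1\le j\le k$), where each $Q_i$ is $\forall$ or $\exists$ and $x_i$ ranges over all vertices, or over the vertices designated by a given set of variables among $x_1,\dots,x_{i-1}$, or over the vertices to which there is an edge from the vertex designated by a given $x_j$, $j<i$. Let $\mathcal F_{k,d}$ be the set of the $k$-indexed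 prenex formulas in which the nesting depth of path quantifiers is at most $d$. **Theorem.** Let $\mathbf G$ be a parameterized topology and let $k,d\in\mathbb N$. Under either convention (a), (b): 1. (Cutoff.) There is $c\in\mathbb N$, depending only on $\mathbf G$, $k$ and $d$ (and on the convention), such that for every process template $P$ and every $\Phi\in\mathcal F_{k,d}$: $$\bigl(P^G\models\Phi\text{ for all }G\in\mathbf G\text{ with }|V_G|\le c\bigr)\iff\bigl(P^G\models\Phi\text{ for all }G\in\mathbf G\bigr).$$ 2. (Decidability.) For these fixed $\mathbf G$, $k$ and $d$ there is an algorithm that, given a process template $P$ (as a finite description) and a formula $\Phi\in\mathcal F_{k,d}$, decides whether $P^G\models\Phi$ for all $G\in\mathbf G$. -/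

import Mathlib

/-! ## Labeled transition systems and `CTL*` without next -/

/-- A labeled transition system with action labels in `Act` over the atoms `AP`. -/
structure LTS (Act : Type) (AP : Type) where
  State : Type
  init : Set State
  tr : State → Act → State → Prop
  label : State → Set AP

namespace LTS

variable {Act AP AP' : Type}

/-- There is a transition from `s` to `t`, with some action label. -/
def Step (M : LTS Act AP) (s t : M.State) : Prop := ∃ a, M.tr s a t

/-- The same transition system, in which the atom `b` is read as the atom `r b`. -/
def relabel (M : LTS Act AP) (r : AP' → AP) : LTS Act AP' where
  State := M.State
  init := M.init
  tr := M.tr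
  label s := {b | r b ∈ M.label s}

end LTS

/-- The two usual conventions for the range of path quantifiers. They agree on transition systems
without deadlocked states. -/
inductive PathConvention where
  /-- Path quantifiers range over the infinite paths. -/
  | infinite
  /-- Path quantifiers range over the maximal paths: the infinite ones and the finite ones that
  end in a deadlocked state. -/
  | maximal

/-- The sequences of states over which path quantifiers range. A finite maximal path is written as
the infinite sequence that repeats its last, deadlocked, state; formulas without the next-time
operator do not distinguish the two. -/
def LTS.IsPath {Act AP : Type} (M : LTS Act AP) : PathConvention → (ℕ → M.State) → Prop
  | .infinite, π => ∀ i, M.Step (π i) (π (i + 1))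
  | .maximal, π =>
      ∀ i, M.Step (π i) (π (i + 1)) ∨ ((∀ t, ¬ M.Step (π i) t) ∧ π (i + 1) = π i)

mutual

/-- State formulas of `CTL*` without next. The universal path quantifier is `¬ E ¬`. -/
inductive StateFormula (AP : Type) : Type where
  | tru : StateFormula AP
  | atom : AP → StateFormula AP
  | neg : StateFormula AP → StateFormula AP
  | and : StateFormula AP → StateFormula AP → StateFormula AP
  | ex : PathFormula AP → StateFormula AP

/-- Path formulas of `CTL*` without next. -/
inductive PathFormula (AP : Type) : Type where
  | ofState : StateFormula AP → PathFormula AP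
  | neg : PathFormula AP → PathFormula AP
  | and : PathFormula AP → PathFormula AP → PathFormula AP
  | until : PathFormula AP → PathFormula AP → PathFormula AP

end

mutual

/-- Satisfaction of a state formula at a state. -/
def StateFormula.Sat {Act AP : Type} (κ : PathConvention) (M : LTS Act AP) :
    StateFormula AP → M.State → Prop
  | .tru, _ => True
  | .atom a, s => a ∈ M.label s
  | .neg φ, s => ¬ φ.Sat κ M s
  | .and φ χ, s => φ.Sat κ M s ∧ χ.Sat κ M s
  | .ex ψ, s => ∃ π : ℕ → M.State, M.IsPath κ π ∧ π 0 = s ∧ ψ.Sat κ M π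

/-- Satisfaction of a path formula along a path. -/
def PathFormula.Sat {Act AP : Type} (κ : PathConvention) (M : LTS Act AP) :
    PathFormula AP → (ℕ → M.State) → Prop
  | .ofState φ, π => φ.Sat κ M (π 0)
  | .neg ψ, π => ¬ ψ.Sat κ M π
  | .and ψ χ, π => ψ.Sat κ M π ∧ χ.Sat κ M π
  | .until ψ χ, π => ∃ j, χ.Sat κ M (fun n => π (j + n)) ∧ ∀ i < j, ψ.Sat κ M (fun n => π (i + n))

end

/-- `M ⊨ φ`: every initial state of `M` satisfies `φ`. -/
def LTS.Models {Act AP : Type} (κ : PathConvention) (M : LTS Act AP) (φ : StateFormula AP) : Prop :=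
  ∀ s ∈ M.init, φ.Sat κ M s

mutual

/-- Nesting depth of path quantifiers. -/
def StateFormula.depth {AP : Type} : StateFormula AP → ℕ
  | .tru => 0
  | .atom _ => 0
  | .neg φ => φ.depth
  | .and φ χ => max φ.depth χ.depth
  | .ex ψ => ψ.depth + 1

/-- Nesting depth of path quantifiers. -/
def PathFormula.depth {AP : Type} : PathFormula AP → ℕ
  | .ofState φ => φ.depth
  | .neg ψ => ψ.depth
  | .and ψ χ => max ψ.depth χ.depth
  | .until ψ χ => max ψ.depth χ.depth

end

/-! ## Direction-unaware token-passing systems -/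

/-- Transition labels of a process template with internal-transition labels `A`. -/
inductive ProcLabel (A : Type) : Type where
  | int : A → ProcLabel A
  | snd : ProcLabel A
  | rcv : ProcLabel A

/-- The transition label is not internal. -/
def ProcLabel.IsSync {A : Type} : ProcLabel A → Prop
  | .int _ => False
  | .snd => True
  | .rcv => True

/-- The infinite word `α` lies in
`(int* snd int* rcv)^ω ∪ (int* rcv int* snd)^ω`: infinitely many of its letters are `snd` or `rcv`,
and any two successive ones among these are different. -/
def Alternates {A : Type} (α : ℕ → ProcLabel A) : Prop :=
  (∀ i, ∃ j, i ≤ j ∧ (α j).IsSync) ∧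
  ∀ i j, i < j → (α i).IsSync → (α j).IsSync → (∀ m, i < m → m < j → ¬ (α m).IsSync) → α i ≠ α j

/-- Direction-unaware process templates. The atomic propositions of processes are the natural
numbers; `hasToken` is the set of the states that have the token. -/
structure ProcessTemplate where
  State : Type
  Act : Type
  finite_state : Finite State
  finite_act : Finite Act
  nonempty_act : Nonempty Act
  hasToken : Set State
  initTok : State
  initNon : State
  initTok_mem : initTok ∈ hasToken
  initNon_notMem : initNon ∉ hasToken
  tr : State → ProcLabel Act → State → Prop
  label : State → Finset ℕ
  snd_spec : ∀ q q', tr q .snd q' → q ∈ hasToken ∧ q' ∉ hasToken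
  rcv_spec : ∀ q q', tr q .rcv q' → q ∉ hasToken ∧ q' ∈ hasToken
  int_spec : ∀ q a q', tr q (.int a) q' → (q ∈ hasToken ↔ q' ∈ hasToken)
  total : ∀ q, ∃ l q', tr q l q'
  alternates : ∀ (ρ : ℕ → State) (α : ℕ → ProcLabel Act),
    (∀ i, tr (ρ i) (α i) (ρ (i + 1))) → Alternates α

/-- Topologies: finite directed graphs without self-loops on the vertices `Fin size`, with an initial
vertex (so that `size` is positive). -/
structure Topology where
  size : ℕ
  Edge : Fin size → Fin size → Prop
  start : Fin size
  irrefl : ∀ v, ¬ Edge v v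

/-- Transition labels of a token-passing system. -/
inductive SysLabel (A : Type) : Type where
  | int : A → SysLabel A
  | tok : SysLabel A

/-- The global transition relation of the system of copies of `P` on the vertices of `G`. -/
def sysTr (P : ProcessTemplate) (G : Topology) (s : Fin G.size → P.State) :
    SysLabel P.Act → (Fin G.size → P.State) → Prop
  | .int a, s' => ∃ v, P.tr (s v) (.int a) (s' v) ∧ ∀ w, w ≠ v → s' w = s w
  | .tok, s' => ∃ v w, G.Edge v w ∧ P.tr (s v) .snd (s' v) ∧ P.tr (s w) .rcv (s' w) ∧
      ∀ u, u ≠ v → u ≠ w → s' u = s u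

/-- The token-passing system `P^G`. The atom `(p, v)` says that `p` holds in the process at `v`. -/
def tokenSystem (P : ProcessTemplate) (G : Topology) :
    LTS (SysLabel P.Act) (ℕ × Fin G.size) where
  State := Fin G.size → P.State
  init := {fun v => if v = G.start then P.initTok else P.initNon}
  tr := sysTr P G
  label s := {a | a.1 ∈ P.label (s a.2)}

/-! ## Prenex indexed formulas -/

/-- The range of an index quantifier in the scope of the `n` index variables `0, …, n - 1`. -/
inductive IndexRange (n : ℕ) : Type where
  /-- All vertices. -/
  | univ : IndexRange n
  /-- The vertices designated by the variables in `Y`. -/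
  | among (Y : Finset (Fin n)) : IndexRange n
  /-- The vertices to which there is an edge from the vertex designated by `y`. -/
  | succ (y : Fin n) : IndexRange n

/-- `Prenex n k`: formulas `Q₁ x₁ … Q_k x_k. φ` with `k` index quantifiers in front of a `CTL*`
state formula without next and with the `n` free index variables `0, …, n - 1`. Each quantifier
binds the next variable `n`. The atom `(p, x)` of the matrix is the indexed atom `p_x`. The
`k`-indexed formulas are those in `Prenex 0 k`. -/
inductive Prenex : ℕ → ℕ → Type where
  | matrix {n : ℕ} (φ : StateFormula (ℕ × Fin n)) : Prenex n 0
  | all {n k : ℕ} (r : IndexRange n) (Φ : Prenex (n + 1) k) : Prenex n (k + 1)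
  | ex {n k : ℕ} (r : IndexRange n) (Φ : Prenex (n + 1) k) : Prenex n (k + 1)

/-- The vertex `v` lies in the given range, when the variables designate the vertices `g`. -/
def IndexRange.Mem {n : ℕ} (G : Topology) (g : Fin n → Fin G.size) (v : Fin G.size) :
    IndexRange n → Prop
  | .univ => True
  | .among Y => ∃ y ∈ Y, v = g y
  | .succ y => G.Edge (g y) v

/-- `P^G ⊨ Φ`, when the free index variables of `Φ` designate the vertices `g`. -/
def Prenex.Holds (κ : PathConvention) (P : ProcessTemplate) (G : Topology) :
    {n k : ℕ} → Prenex n k → (Fin n → Fin G.size) → Prop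
  | _, _, .matrix φ, g =>
      ((tokenSystem P G).relabel fun a => (a.1, g a.2)).Models κ φ
  | _, _, .all r Φ, g => ∀ v, r.Mem G g v → Φ.Holds κ P G (Fin.snoc g v)
  | _, _, .ex r Φ, g => ∃ v, r.Mem G g v ∧ Φ.Holds κ P G (Fin.snoc g v)

/-- `P^G ⊨ Φ` for a formula without free index variables. -/
def SystemModels (κ : PathConvention) (P : ProcessTemplate) (G : Topology) {k : ℕ}
    (Φ : Prenex 0 k) : Prop :=
  Φ.Holds κ P G Fin.elim0

/-- Nesting depth of path quantifiers. -/
def Prenex.depth : {n k : ℕ} → Prenex n k → ℕ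
  | _, _, .matrix φ => φ.depth
  | _, _, .all _ Φ => Φ.depth
  | _, _, .ex _ Φ => Φ.depth

/-- The `k`-indexed prenex `CTL*` formulas without next of path-quantifier nesting depth at
most `d`. -/
def boundedDepth (k d : ℕ) : Set (Prenex 0 k) := {Φ | Φ.depth ≤ d}

/-! ## Cutoffs -/

/-- `c` is a cutoff for the parameterized model checking problem for the set of topologies `𝒢`,
all direction-unaware process templates, and the formulas in `F`. -/
def IsCutoff (κ : PathConvention) (𝒢 : Set Topology) {k : ℕ} (F : Set (Prenex 0 k)) (c : ℕ) :
    Prop :=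
  ∀ P : ProcessTemplate, ∀ Φ ∈ F,
    (∀ G ∈ 𝒢, G.size ≤ c → SystemModels κ P G Φ) ↔ ∀ G ∈ 𝒢, SystemModels κ P G Φ

/-! ## Decidability: the finite descriptions that an algorithm takes as input -/

mutual

/-- Gödel number of a state formula. -/
def StateFormula.code {n : ℕ} : StateFormula (ℕ × Fin n) → ℕ
  | .tru => Nat.pair 1 0
  | .atom a => Nat.pair 2 (Nat.pair a.1 a.2)
  | .neg φ => Nat.pair 3 φ.code
  | .and φ χ => Nat.pair 4 (Nat.pair φ.code χ.code)
  | .ex ψ => Nat.pair 5 ψ.code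

/-- Gödel number of a path formula. -/
def PathFormula.code {n : ℕ} : PathFormula (ℕ × Fin n) → ℕ
  | .ofState φ => Nat.pair 1 φ.code
  | .neg ψ => Nat.pair 2 ψ.code
  | .and ψ χ => Nat.pair 3 (Nat.pair ψ.code χ.code)
  | .until ψ χ => Nat.pair 4 (Nat.pair ψ.code χ.code)

end

/-- Gödel number of a range; a set of variables is coded by its binary expansion. -/
def IndexRange.code {n : ℕ} : IndexRange n → ℕ
  | .univ => Nat.pair 1 0
  | .among Y => Nat.pair 2 (∑ y ∈ Y, 2 ^ (y : ℕ))
  | .succ y => Nat.pair 3 y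

/-- Gödel number of a prenex indexed formula. -/
def Prenex.code : {n k : ℕ} → Prenex n k → ℕ
  | _, _, .matrix φ => Nat.pair 1 φ.code
  | _, _, .all r Φ => Nat.pair 2 (Nat.pair r.code Φ.code)
  | _, _, .ex r Φ => Nat.pair 3 (Nat.pair r.code Φ.code)

/-- A finite description of a process template: states and internal-transition labels are
numbered, sets and relations are listed. -/
structure TemplateCode where
  states : ℕ
  acts : ℕ
  hasToken : List ℕ
  initTok : ℕ
  initNon : ℕ
  /-- Triples of source, label number, target. -/
  tr : List (ℕ × ℕ × ℕ)
  /-- Pairs of a state and an atom that is true in it. -/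
  label : List (ℕ × ℕ)

/-- Descriptions as tuples. -/
def TemplateCode.equivTuple : TemplateCode ≃
    ℕ × ℕ × List ℕ × ℕ × ℕ × List (ℕ × ℕ × ℕ) × List (ℕ × ℕ) where
  toFun c := (c.states, c.acts, c.hasToken, c.initTok, c.initNon, c.tr, c.label)
  invFun t := ⟨t.1, t.2.1, t.2.2.1, t.2.2.2.1, t.2.2.2.2.1, t.2.2.2.2.2.1, t.2.2.2.2.2.2⟩
  left_inv _ := rfl
  right_inv _ := rfl

instance : Primcodable TemplateCode := Primcodable.ofEquiv _ TemplateCode.equivTuple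

/-- The number of a transition label, from a numbering of the internal ones. -/
def ProcLabel.number {A : Type} {m : ℕ} (e : A ≃ Fin m) : ProcLabel A → ℕ
  | .snd => 0
  | .rcv => 1
  | .int a => (e a : ℕ) + 2

/-- `c` describes `P`, for some numbering of the states and of the internal labels of `P`. -/
def TemplateCode.Represents (c : TemplateCode) (P : ProcessTemplate) : Prop :=
  ∃ (e : P.State ≃ Fin c.states) (a : P.Act ≃ Fin c.acts),
    (∀ q, q ∈ P.hasToken ↔ (e q : ℕ) ∈ c.hasToken) ∧
    (e P.initTok : ℕ) = c.initTok ∧ (e P.initNon : ℕ) = c.initNon ∧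
    (∀ q l q', P.tr q l q' ↔ ((e q : ℕ), l.number a, (e q' : ℕ)) ∈ c.tr) ∧
    ∀ q p, p ∈ P.label q ↔ ((e q : ℕ), p) ∈ c.label

/-- The parameterized model checking problem for the set of topologies `𝒢`, all direction-unaware
process templates, and the formulas in `F` is decidable: some algorithm, given a description of a
process template `P` and a formula `Φ` in `F`, decides whether `P^G ⊨ Φ` for all `G` in `𝒢`. -/
def PMCPDecidable (κ : PathConvention) (𝒢 : Set Topology) {k : ℕ} (F : Set (Prenex 0 k)) : Prop :=
  ∃ f : TemplateCode → ℕ → Bool, Computable₂ f ∧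
    ∀ (P : ProcessTemplate) (c : TemplateCode), c.Represents P → ∀ Φ ∈ F,
      (f c Φ.code = true ↔ ∀ G ∈ 𝒢, SystemModels κ P G Φ)

/-! ## Sequences and stuttering -/

theorem exists_seq_of_forall_exists {α : Type*} {Q : α → Prop} {r : α → α → Prop}
    (h : ∀ a, Q a → ∃ b, r a b ∧ Q b) {a : α} (ha : Q a) :
    ∃ p : ℕ → α, p 0 = a ∧ ∀ i, r (p i) (p (i + 1)) ∧ Q (p i) := by
  choose! f hf using h
  have hQ : ∀ i, Q (f^[i] a) := by
    intro i
    induction i with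
    | zero => exact ha
    | succ i ih => rw [Function.iterate_succ_apply']; exact (hf _ ih).2
  refine ⟨fun i => f^[i] a, rfl, fun i => ⟨?_, hQ i⟩⟩
  simp only [Function.iterate_succ_apply']
  exact (hf _ (hQ i)).1

/-- Positions of two words can be related in such a way that the relation advances along both
words without skipping positions. -/
structure ZigZag (M : ℕ → ℕ → Prop) : Prop where
  zero : M 0 0
  zig : ∀ {i t}, M i t → ∀ j, i ≤ j → ∃ u, t ≤ u ∧ M j u ∧ ∀ x, t ≤ x → x < u →
    ∃ y, i ≤ y ∧ y < j ∧ M y x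
  zag : ∀ {i t}, M i t → ∀ u, t ≤ u → ∃ j, i ≤ j ∧ M j u ∧ ∀ y, i ≤ y → y < j →
    ∃ x, t ≤ x ∧ x < u ∧ M y x

/-- Two words are equal up to repetition of letters. -/
def StutterEquiv {O : Type*} (w w' : ℕ → O) : Prop :=
  ∃ M, ZigZag M ∧ ∀ i t, M i t → w i = w' t

theorem PathFormula.sat_iff_of_zigZag {A A' AP : Type} {κ : PathConvention} {M : LTS A AP}
    {N : LTS A' AP} {d : ℕ} {π : ℕ → M.State} {π' : ℕ → N.State} {Z : ℕ → ℕ → Prop}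
    (hZ : ZigZag Z)
    (h : ∀ i t, Z i t → ∀ φ : StateFormula AP, φ.depth ≤ d →
      (φ.Sat κ M (π i) ↔ φ.Sat κ N (π' t))) :
    ∀ ψ : PathFormula AP, ψ.depth ≤ d → ∀ i t, Z i t →
      (ψ.Sat κ M (fun n => π (i + n)) ↔ ψ.Sat κ N (fun n => π' (t + n)))
  | .ofState φ, hd, i, t, hit => by
      simpa [PathFormula.Sat] using h i t hit φ (by simpa [PathFormula.depth] using hd)
  | .neg ψ, hd, i, t, hit => by
      have := PathFormula.sat_iff_of_zigZag hZ h ψ (by simpa [PathFormula.depth] using hd) i t hit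
      simp only [PathFormula.Sat, this]
  | .and ψ χ, hd, i, t, hit => by
      simp only [PathFormula.depth, max_le_iff] at hd
      have h1 := PathFormula.sat_iff_of_zigZag hZ h ψ hd.1 i t hit
      have h2 := PathFormula.sat_iff_of_zigZag hZ h χ hd.2 i t hit
      simp only [PathFormula.Sat, h1, h2]
  | .until ψ χ, hd, i, t, hit => by
      simp only [PathFormula.depth, max_le_iff] at hd
      have h1 := PathFormula.sat_iff_of_zigZag hZ h ψ hd.1
      have h2 := PathFormula.sat_iff_of_zigZag hZ h χ hd.2
      simp only [PathFormula.Sat, ← Nat.add_assoc]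
      constructor
      · rintro ⟨j, hj, hb⟩
        obtain ⟨u, htu, hju, hx⟩ := hZ.zig hit (i + j) (by omega)
        refine ⟨u - t, ?_, fun x hxu => ?_⟩
        · rw [Nat.add_sub_cancel' htu]
          exact (h2 _ _ hju).1 hj
        · obtain ⟨y, hy1, hy2, hy3⟩ := hx (t + x) (by omega) (by omega)
          have := hb (y - i) (by omega)
          rw [Nat.add_sub_cancel' hy1] at this
          exact (h1 _ _ hy3).1 this
      · rintro ⟨j, hj, hb⟩
        obtain ⟨u, htu, hju, hx⟩ := hZ.zag hit (t + j) (by omega)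
        refine ⟨u - i, ?_, fun x hxu => ?_⟩
        · rw [Nat.add_sub_cancel' htu]
          exact (h2 _ _ hju).2 hj
        · obtain ⟨y, hy1, hy2, hy3⟩ := hx (i + x) (by omega) (by omega)
          have := hb (y - t) (by omega)
          rw [Nat.add_sub_cancel' hy1] at this
          exact (h1 _ _ hy3).2 this

theorem exists_last_index {idx : ℕ → ℕ} (h0 : idx 0 = 0) (j : ℕ) :
    ∃ u, idx u ≤ j ∧ ∀ v, idx u < idx v → j < idx v := by
  induction j with
  | zero => exact ⟨0, h0.le, fun v hv => by omega⟩
  | succ j ih =>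
    obtain ⟨u, hu, hv⟩ := ih
    by_cases h : ∃ v, idx v = j + 1
    · obtain ⟨v, hv⟩ := h
      exact ⟨v, hv.le, fun x hx => by omega⟩
    · push Not at h
      exact ⟨u, by omega, fun v hv' => by have := hv v hv'; have := h v; omega⟩

theorem zigZag_of_index {idx : ℕ → ℕ} (h0 : idx 0 = 0) (hm : Monotone idx) :
    ZigZag fun i t => idx t ≤ i ∧ ∀ u, idx t < idx u → i < idx u where
  zero := ⟨h0.le, fun u hu => by omega⟩
  zig := by
    rintro i t ⟨hit, hit'⟩ j hij
    obtain ⟨u, hu, hu'⟩ := exists_last_index h0 j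
    have htu : idx t ≤ idx u := by
      by_contra hlt
      have := hu' t (by omega)
      omega
    rcases htu.eq_or_lt with heq | hlt
    · exact ⟨t, le_rfl, ⟨by omega, fun v hv => hu' v (by omega)⟩, fun x h1 h2 => by omega⟩
    · have hex : ∃ v, idx v = idx u := ⟨u, rfl⟩
      classical
      have hv := Nat.find_spec hex
      have hmin := @Nat.find_min _ _ hex
      set v := Nat.find hex
      have htv : t ≤ v := by
        by_contra hc
        have := hm (show v ≤ t by omega)
        omega
      refine ⟨v, htv, ⟨by omega, fun x hx => hu' x (by omega)⟩, fun x hx1 hx2 => ?_⟩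
      have hxlt : idx x < idx u :=
        lt_of_le_of_ne (by have := hm hx2.le; omega) (hmin hx2)
      have hi := hit' u hlt
      rcases (hm hx1).eq_or_lt with h | h
      · exact ⟨i, le_rfl, by omega, by omega, fun z hz => hit' z (by omega)⟩
      · exact ⟨idx x, (hit' x h).le, by omega, le_rfl, fun z hz => hz⟩
  zag := by
    rintro i t ⟨hit, hit'⟩ u htu
    rcases (hm htu).eq_or_lt with h | h
    · exact ⟨i, le_rfl, ⟨by omega, fun v hv => hit' v (by omega)⟩, fun y h1 h2 => by omega⟩
    · refine ⟨idx u, (hit' u h).le, ⟨le_rfl, fun v hv => hv⟩, fun x hx1 hx2 => ?_⟩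
      obtain ⟨z, hz, hz'⟩ := exists_last_index h0 x
      have hzu : z < u := by
        by_contra hc
        have := hm (show u ≤ z by omega)
        omega
      have htz : idx t ≤ idx z := by
        by_contra hc
        have := hz' t (by omega)
        omega
      rcases htz.eq_or_lt with h3 | h3
      · have htu' : t < u := by
          rcases htu.eq_or_lt with h4 | h4
          · subst h4; omega
          · exact h4
        exact ⟨t, le_rfl, htu', by omega, fun v hv => hz' v (by omega)⟩
      · have : t ≤ z := by
          by_contra hc
          have := hm (show z ≤ t by omega)
          omega
        exact ⟨z, this, hzu, hz, hz'⟩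

/-- A word is traversed by blocks of equal letters, at the positions `idx`. -/
theorem stutterEquiv_of_index {O : Type*} {w w' : ℕ → O} {idx : ℕ → ℕ} (h0 : idx 0 = 0)
    (hm : Monotone idx) (hw : ∀ t, w' t = w (idx t))
    (hblock : ∀ t l, idx t ≤ l → l < idx (t + 1) → w l = w (idx t))
    (hlast : ∀ t, (∀ u, t ≤ u → idx u = idx t) → ∀ l, idx t ≤ l → w l = w (idx t)) :
    StutterEquiv w w' := by
  refine ⟨_, zigZag_of_index h0 hm, ?_⟩
  rintro i t ⟨hit, hit'⟩
  rw [hw]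
  by_cases hex : ∃ u, idx t < idx u
  · classical
    have hu := Nat.find_spec hex
    have hmin := @Nat.find_min _ _ hex
    generalize Nat.find hex = u at hu hmin
    have htu : t < u := by
      by_contra hc
      have := hm (show u ≤ t by omega)
      omega
    obtain ⟨v, rfl⟩ : ∃ v, u = v + 1 := ⟨u - 1, by omega⟩
    have h1 := hmin (show v < v + 1 by omega)
    have h2 := hm (show t ≤ v by omega)
    have h3 : idx v = idx t := by omega
    rw [← h3]
    exact hblock v i (by omega) (hit' _ hu)
  · push Not at hex
    exact hlast t (fun u hu => le_antisymm (hex u) (hm hu)) i hit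

/-- `Reaches R obs w Inv n i s`: in `n` steps with constant observation and one more step, a state
is reached that satisfies the invariant for a later position of `w`. -/
def Reaches {S O : Type*} (R : S → S → Prop) (obs : S → O) (w : ℕ → O) (Inv : ℕ → S → Prop) :
    ℕ → ℕ → S → Prop
  | 0, i, s => obs s = w i ∧ ∃ j, i < j ∧ (∀ l, i ≤ l → l < j → w l = w i) ∧
      ∃ s', R s s' ∧ Inv j s'
  | n + 1, i, s => obs s = w i ∧ ∃ s', R s s' ∧ Reaches R obs w Inv n i s'

/-- Stepwise construction of a path that has a given word of observations up to stuttering. -/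
theorem exists_path_stutterEquiv {S O : Type*} {R : S → S → Prop} {obs : S → O} {w : ℕ → O}
    {Inv : ℕ → S → Prop}
    (h : ∀ i s, Inv i s → obs s = w i ∧
      ((∃ j, i < j ∧ (∀ l, i ≤ l → l < j → w l = w i) ∧
        ∃ s₁ s₂, Relation.ReflTransGen (fun a b => R a b ∧ obs b = obs a) s s₁ ∧ R s₁ s₂ ∧
          Inv j s₂) ∨
      ((∀ l, i ≤ l → w l = w i) ∧
        ∃ p : ℕ → S, p 0 = s ∧ ∀ n, R (p n) (p (n + 1)) ∧ obs (p n) = obs s)))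
    {s₀ : S} (h₀ : Inv 0 s₀) :
    ∃ p : ℕ → S, p 0 = s₀ ∧ (∀ n, R (p n) (p (n + 1))) ∧ StutterEquiv w (fun n => obs (p n)) := by
  set Ends : ℕ → S → Prop := fun i s => obs s = w i ∧ (∀ l, i ≤ l → w l = w i) ∧
    ∃ p : ℕ → S, p 0 = s ∧ ∀ n, R (p n) (p (n + 1)) ∧ obs (p n) = obs s with hEnds
  set Val : ℕ × S × ℕ → Prop := fun c => Reaches R obs w Inv c.2.2 c.1 c.2.1 ∨ Ends c.1 c.2.1
    with hVal
  have hval : ∀ i s, Inv i s → ∃ n, Val (i, s, n) := by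
    intro i s his
    obtain ⟨ho, h1 | h1⟩ := h i s his
    · obtain ⟨j, hij, hc, s₁, s₂, h12, hR, hj⟩ := h1
      have : ∀ a, Relation.ReflTransGen (fun a b => R a b ∧ obs b = obs a) a s₁ → obs a = w i →
          ∃ n, Reaches R obs w Inv n i a := by
        intro a ha
        induction ha using Relation.ReflTransGen.head_induction_on with
        | refl => exact fun ho => ⟨0, ho, j, hij, hc, s₂, hR, hj⟩
        | head hab _ ih =>
          intro ho
          obtain ⟨n, hn⟩ := ih (by rw [hab.2, ho])
          exact ⟨n + 1, ho, _, hab.1, hn⟩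
      obtain ⟨n, hn⟩ := this s h12 ho
      exact ⟨n, Or.inl hn⟩
    · exact ⟨0, Or.inr ⟨ho, h1⟩⟩
  have hobs : ∀ c, Val c → obs c.2.1 = w c.1 := by
    rintro ⟨i, s, n⟩ (hc | hc)
    · cases n <;> exact hc.1
    · exact hc.1
  have hstep : ∀ c, Val c → ∃ c', (R c.2.1 c'.2.1 ∧
      ((c'.1 = c.1 ∧ (c'.2.2 < c.2.2 ∨ ∀ l, c.1 ≤ l → w l = w c.1)) ∨
        (c.1 < c'.1 ∧ ∀ l, c.1 ≤ l → l < c'.1 → w l = w c.1))) ∧ Val c' := by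
    rintro ⟨i, s, n⟩ (hc | hc)
    · cases n with
      | zero =>
        obtain ⟨ho, j, hij, hcon, s', hR, hj⟩ := hc
        obtain ⟨m, hm⟩ := hval j s' hj
        exact ⟨(j, s', m), ⟨hR, Or.inr ⟨hij, hcon⟩⟩, hm⟩
      | succ n =>
        obtain ⟨ho, s', hR, hn⟩ := hc
        exact ⟨(i, s', n), ⟨hR, Or.inl ⟨rfl, Or.inl (Nat.lt_succ_self n)⟩⟩, Or.inl hn⟩
    · obtain ⟨ho, hcon, p, hp0, hp⟩ := hc
      refine ⟨(i, p 1, 0), ⟨by simpa [hp0] using (hp 0).1, Or.inl ⟨rfl, Or.inr hcon⟩⟩, Or.inr ?_⟩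
      refine ⟨by rw [(hp 1).2]; exact ho, hcon, fun n => p (n + 1), rfl, fun n => ⟨(hp _).1, ?_⟩⟩
      rw [(hp _).2, (hp 1).2]
  obtain ⟨n₀, hn₀⟩ := hval 0 s₀ h₀
  obtain ⟨c, hc0, hc⟩ := exists_seq_of_forall_exists hstep hn₀
  have hm1 : ∀ t, (c t).1 ≤ (c (t + 1)).1 := by
    intro t
    rcases (hc t).1.2 with h1 | h1
    · exact h1.1.ge
    · exact h1.1.le
  refine ⟨fun t => (c t).2.1, by simp [hc0], fun t => (hc t).1.1, ?_⟩
  refine stutterEquiv_of_index (idx := fun t => (c t).1) (by simp [hc0])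
    (monotone_nat_of_le_succ hm1) (fun t => hobs _ (hc t).2) ?_ ?_
  · intro t l hl hl'
    rcases (hc t).1.2 with h1 | h1
    · omega
    · exact h1.2 l hl hl'
  · intro t ht l hl
    by_contra hne
    have hdec : ∀ u, (c (t + u)).2.2 + u ≤ (c t).2.2 := by
      intro u
      induction u with
      | zero => simp
      | succ u ih =>
        have e1 := ht (t + u) (by omega)
        have e2 := ht (t + u + 1) (by omega)
        rcases (hc (t + u)).1.2 with ⟨_, h1 | h1⟩ | h1
        · have : t + (u + 1) = t + u + 1 := rfl
          rw [this]
          omega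
        · rw [e1] at h1
          exact absurd (h1 l hl) hne
        · omega
    have := hdec ((c t).2.2 + 1)
    omega

/-! ## Paths as sequences of single steps -/

/-- The steps of the sequences over which path quantifiers range. -/
def LTS.PathStep {A AP : Type} (M : LTS A AP) (κ : PathConvention) (s t : M.State) : Prop :=
  M.Step s t ∨ (κ = .maximal ∧ (∀ u, ¬ M.Step s u) ∧ t = s)

theorem LTS.isPath_iff {A AP : Type} {M : LTS A AP} {κ : PathConvention} {π : ℕ → M.State} :
    M.IsPath κ π ↔ ∀ i, M.PathStep κ (π i) (π (i + 1)) := by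
  cases κ <;> simp [LTS.IsPath, LTS.PathStep]

/-! ## Process templates -/

namespace ProcessTemplate

variable (P : ProcessTemplate)

/-- There is an internal transition from `q` to `q'`. -/
def IntStep (q q' : P.State) : Prop := ∃ a, P.tr q (.int a) q'

theorem not_forall_intStep (ρ : ℕ → P.State) : ¬ ∀ i, P.IntStep (ρ i) (ρ (i + 1)) := by
  intro h
  choose α hα using h
  obtain ⟨j, _, hj⟩ := (P.alternates ρ (fun i => .int (α i)) hα).1 0
  exact hj

theorem wellFounded_intStep : WellFounded fun q' q => P.IntStep q q' := by
  rw [wellFounded_iff_isEmpty_descending_chain]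
  exact ⟨fun f => P.not_forall_intStep f.1 f.2⟩

/-- Number of states that are reachable by internal transitions. -/
noncomputable def height (q : P.State) : ℕ := {q' | Relation.TransGen P.IntStep q q'}.ncard

theorem height_lt {q q' : P.State} (h : P.IntStep q q') : P.height q' < P.height q := by
  have := P.finite_state
  refine Set.ncard_lt_ncard ?_ (Set.toFinite _)
  refine (Set.ssubset_iff_of_subset fun x hx => Relation.TransGen.head h hx).2
    ⟨q', Relation.TransGen.single h, fun hq => ?_⟩
  have hwf := P.wellFounded_intStep.transGen
  exact hwf.irrefl.irrefl q' (Relation.transGen_swap.2 hq)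

variable {P}

theorem mem_hasToken_iff {q q' : P.State} (h : P.IntStep q q') :
    q ∈ P.hasToken ↔ q' ∈ P.hasToken := by
  obtain ⟨a, ha⟩ := h
  exact P.int_spec q a q' ha

theorem exists_snd {q : P.State} (hq : q ∈ P.hasToken) :
    ∃ q₁ q₂, Relation.ReflTransGen P.IntStep q q₁ ∧ P.tr q₁ .snd q₂ := by
  induction q using P.wellFounded_intStep.induction with
  | _ q ih =>
    obtain ⟨l, q', h⟩ := P.total q
    cases l with
    | int a =>
      obtain ⟨q₁, q₂, h1, h2⟩ := ih q' ⟨a, h⟩ ((mem_hasToken_iff ⟨a, h⟩).1 hq)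
      exact ⟨q₁, q₂, .head ⟨a, h⟩ h1, h2⟩
    | snd => exact ⟨q, q', .refl, h⟩
    | rcv => exact absurd hq (P.rcv_spec _ _ h).1

theorem exists_rcv {q : P.State} (hq : q ∉ P.hasToken) :
    ∃ q₁ q₂, Relation.ReflTransGen P.IntStep q q₁ ∧ P.tr q₁ .rcv q₂ := by
  induction q using P.wellFounded_intStep.induction with
  | _ q ih =>
    obtain ⟨l, q', h⟩ := P.total q
    cases l with
    | int a =>
      obtain ⟨q₁, q₂, h1, h2⟩ := ih q' ⟨a, h⟩ (fun h' => hq ((mem_hasToken_iff ⟨a, h⟩).2 h'))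
      exact ⟨q₁, q₂, .head ⟨a, h⟩ h1, h2⟩
    | rcv => exact ⟨q, q', .refl, h⟩
    | snd => exact absurd (P.snd_spec _ _ h).1 hq

end ProcessTemplate

/-! ## Token-passing systems -/

section TokenSystem

variable {P : ProcessTemplate} {G : Topology}

/-- Exactly the process at `v` has the token. -/
def HasTok (P : ProcessTemplate) {G : Topology} (s : Fin G.size → P.State) (v : Fin G.size) :
    Prop :=
  ∀ w, s w ∈ P.hasToken ↔ w = v

theorem HasTok.unique {s : Fin G.size → P.State} {v w : Fin G.size} (hv : HasTok P s v)
    (hw : HasTok P s w) : v = w :=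
  (hw v).1 ((hv v).2 rfl)

/-- The process at `v` makes an internal transition. -/
def IntMove (P : ProcessTemplate) {G : Topology} (v : Fin G.size)
    (s t : Fin G.size → P.State) : Prop :=
  P.IntStep (s v) (t v) ∧ ∀ w, w ≠ v → t w = s w

/-- The token moves from `v` to `w`. -/
def TokMove (P : ProcessTemplate) {G : Topology} (v w : Fin G.size)
    (s t : Fin G.size → P.State) : Prop :=
  G.Edge v w ∧ P.tr (s v) .snd (t v) ∧ P.tr (s w) .rcv (t w) ∧ ∀ u, u ≠ v → u ≠ w → t u = s u

theorem tokenSystem_step_iff {s t : Fin G.size → P.State} :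
    (tokenSystem P G).Step s t ↔ (∃ v, IntMove P v s t) ∨ ∃ v w, TokMove P v w s t := by
  constructor
  · rintro ⟨a | _, h⟩
    · obtain ⟨v, h1, h2⟩ := h
      exact Or.inl ⟨v, ⟨a, h1⟩, h2⟩
    · exact Or.inr h
  · rintro (⟨v, ⟨a, h1⟩, h2⟩ | h)
    · exact ⟨.int a, v, h1, h2⟩
    · exact ⟨.tok, h⟩

theorem HasTok.intMove {s t : Fin G.size → P.State} {v z : Fin G.size} (hs : HasTok P s v)
    (h : IntMove P z s t) : HasTok P t v := by
  intro w
  by_cases hw : w = z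
  · subst hw
    rw [← ProcessTemplate.mem_hasToken_iff h.1, hs]
  · rw [h.2 w hw, hs]

theorem HasTok.tokMove {s t : Fin G.size → P.State} {v a b : Fin G.size} (hs : HasTok P s v)
    (h : TokMove P a b s t) : a = v ∧ HasTok P t b := by
  obtain ⟨he, h1, h2, h3⟩ := h
  have ha : a = v := (hs a).1 (P.snd_spec _ _ h1).1
  refine ⟨ha, fun w => ?_⟩
  by_cases hwb : w = b
  · subst hwb
    simp [(P.rcv_spec _ _ h2).2]
  by_cases hwa : w = a
  · subst hwa
    simp [(P.snd_spec _ _ h1).2, hwb]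
  · rw [h3 w hwa hwb, hs, ← ha]
    simp [hwa, hwb]

theorem HasTok.step {s t : Fin G.size → P.State} {v : Fin G.size} (hs : HasTok P s v)
    (h : (tokenSystem P G).Step s t) : ∃ w, HasTok P t w ∧ (w = v ∨ G.Edge v w) := by
  rcases tokenSystem_step_iff.1 h with ⟨z, hz⟩ | ⟨a, b, hab⟩
  · exact ⟨v, hs.intMove hz, Or.inl rfl⟩
  · obtain ⟨rfl, h2⟩ := hs.tokMove hab
    exact ⟨b, h2, Or.inr hab.1⟩

theorem HasTok.deadlock {s : Fin G.size → P.State} {v : Fin G.size} (hs : HasTok P s v)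
    (h : ∀ t, ¬ (tokenSystem P G).Step s t) :
    (∀ w, ¬ G.Edge v w) ∧ ∀ z q, ¬ P.IntStep (s z) q := by
  have hint : ∀ z q, ¬ P.IntStep (s z) q := fun z q hq =>
    h (Function.update s z q) (tokenSystem_step_iff.2 (Or.inl ⟨z, by simpa using hq,
      fun w hw => by simp [hw]⟩))
  refine ⟨fun w hvw => ?_, hint⟩
  have hne : w ≠ v := fun e => G.irrefl v (by rwa [e] at hvw)
  obtain ⟨l, q, hq⟩ := P.total (s v)
  obtain ⟨l', q', hq'⟩ := P.total (s w)
  have hv := (hs v).2 rfl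
  have hw : s w ∉ P.hasToken := fun e => hne ((hs w).1 e)
  cases l with
  | int a => exact hint _ _ ⟨a, hq⟩
  | rcv => exact (P.rcv_spec _ _ hq).1 hv
  | snd =>
    cases l' with
    | int a => exact hint _ _ ⟨a, hq'⟩
    | snd => exact hw (P.snd_spec _ _ hq').1
    | rcv =>
      refine h (Function.update (Function.update s v q) w q') (tokenSystem_step_iff.2 (Or.inr
        ⟨v, w, hvw, ?_, ?_, ?_⟩))
      · simpa [hne.symm] using hq
      · simpa using hq'
      · intro u h1 h2
        simp [h1, h2]

theorem sum_height_lt {s t : Fin G.size → P.State} {z : Fin G.size} (h : IntMove P z s t) :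
    ∑ v, P.height (t v) < ∑ v, P.height (s v) := by
  refine Finset.sum_lt_sum (fun v _ => ?_) ⟨z, Finset.mem_univ _, P.height_lt h.1⟩
  by_cases hv : v = z
  · subst hv; exact (P.height_lt h.1).le
  · rw [h.2 v hv]

/-- The token moves infinitely often along an infinite path. -/
theorem exists_tokMove {π : ℕ → Fin G.size → P.State}
    (hπ : ∀ i, (tokenSystem P G).Step (π i) (π (i + 1))) (i : ℕ) :
    ∃ j, i ≤ j ∧ ∃ v w, TokMove P v w (π j) (π (j + 1)) := by
  by_contra hc
  push Not at hc
  have h : ∀ j, ∑ v, P.height (π (i + j) v) + j ≤ ∑ v, P.height (π i v) := by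
    intro j
    induction j with
    | zero => simp
    | succ j ih =>
      rcases tokenSystem_step_iff.1 (hπ (i + j)) with ⟨z, hz⟩ | ⟨a, b, hab⟩
      · have := sum_height_lt hz
        rw [← Nat.add_assoc i j 1]
        omega
      · exact absurd hab (hc _ (by omega) a b)
  have := h (∑ v, P.height (π i v) + 1)
  omega

/-- A step that changes neither the states of the processes at the vertices `g` nor the place of
the token. -/
def QuietStep (P : ProcessTemplate) {G : Topology} {n : ℕ} (g : Fin n → Fin G.size)
    (s t : Fin G.size → P.State) : Prop :=
  (tokenSystem P G).Step s t ∧ (∀ x, t (g x) = s (g x)) ∧ ∀ v, HasTok P s v → HasTok P t v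

variable {n : ℕ} {g : Fin n → Fin G.size}

theorem reflTransGen_quietStep_update {s : Fin G.size → P.State} {z : Fin G.size} {q : P.State}
    (h : Relation.ReflTransGen P.IntStep (s z) q) (hz : (∃ x, g x = z) → q = s z) :
    Relation.ReflTransGen (QuietStep P g) s (Function.update s z q) := by
  by_cases hw : ∃ x, g x = z
  · rw [hz hw, Function.update_eq_self]
  · clear hz
    induction h with
    | refl => rw [Function.update_eq_self]
    | @tail b c _ hbc ih =>
      have hm : IntMove P z (Function.update s z b) (Function.update s z c) := by
        refine ⟨by simpa using hbc, fun w hw => by simp [hw]⟩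
      refine ih.tail ⟨tokenSystem_step_iff.2 (Or.inl ⟨z, hm⟩), fun x => ?_,
        fun v hv => hv.intMove hm⟩
      exact hm.2 _ fun e => hw ⟨x, e⟩

/-- The token can be moved along any edge, after internal transitions of the processes outside
`g`. -/
theorem HasTok.exists_pass {s : Fin G.size → P.State} {a b : Fin G.size} (hs : HasTok P s a)
    (hab : G.Edge a b) {qa qb : P.State} (ha : (∃ x, g x = a) → P.tr (s a) .snd qa)
    (hb : (∃ x, g x = b) → P.tr (s b) .rcv qb) :
    ∃ s₁ s₂, Relation.ReflTransGen (QuietStep P g) s s₁ ∧ (tokenSystem P G).Step s₁ s₂ ∧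
      HasTok P s₁ a ∧ HasTok P s₂ b ∧ (∀ x, g x ≠ a → g x ≠ b → s₂ (g x) = s (g x)) ∧
      (∀ x, s₁ (g x) = s (g x)) ∧
      ((∃ x, g x = a) → s₂ a = qa) ∧ ((∃ x, g x = b) → s₂ b = qb) := by
  have hne : b ≠ a := fun e => G.irrefl a (by rwa [e] at hab)
  obtain ⟨a₁, a₂, ha1, ha2, ha3⟩ : ∃ q₁ q₂, Relation.ReflTransGen P.IntStep (s a) q₁ ∧
      P.tr q₁ .snd q₂ ∧ ((∃ x, g x = a) → q₁ = s a ∧ q₂ = qa) := by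
    by_cases hx : ∃ x, g x = a
    · exact ⟨s a, qa, .refl, ha hx, fun _ => ⟨rfl, rfl⟩⟩
    · obtain ⟨q₁, q₂, h1, h2⟩ := P.exists_snd ((hs a).2 rfl)
      exact ⟨q₁, q₂, h1, h2, fun h => absurd h hx⟩
  obtain ⟨b₁, b₂, hb1, hb2, hb3⟩ : ∃ q₁ q₂, Relation.ReflTransGen P.IntStep (s b) q₁ ∧
      P.tr q₁ .rcv q₂ ∧ ((∃ x, g x = b) → q₁ = s b ∧ q₂ = qb) := by
    by_cases hx : ∃ x, g x = b
    · exact ⟨s b, qb, .refl, hb hx, fun _ => ⟨rfl, rfl⟩⟩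
    · obtain ⟨q₁, q₂, h1, h2⟩ := P.exists_rcv (fun e => hne ((hs b).1 e))
      exact ⟨q₁, q₂, h1, h2, fun h => absurd h hx⟩
  set s₁ := Function.update (Function.update s a a₁) b b₁ with hs1
  have hq : Relation.ReflTransGen (QuietStep P g) s s₁ := by
    refine (reflTransGen_quietStep_update ha1 fun h => (ha3 h).1).trans
      (reflTransGen_quietStep_update ?_ fun h => ?_)
    · simpa [hne] using hb1
    · simpa [hne] using (hb3 h).1
  have htm : TokMove P a b s₁ (Function.update (Function.update s₁ a a₂) b b₂) := by
    refine ⟨hab, ?_, ?_, fun u h1 h2 => by simp [h1, h2]⟩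
    · simpa [hs1, hne.symm] using ha2
    · simpa [hs1] using hb2
  have hinv : ∀ t, Relation.ReflTransGen (QuietStep P g) s t →
      HasTok P t a ∧ ∀ x, t (g x) = s (g x) := by
    intro t ht
    induction ht with
    | refl => exact ⟨hs, fun _ => rfl⟩
    | tail _ h ih => exact ⟨h.2.2 _ ih.1, fun x => by rw [h.2.1, ih.2]⟩
  obtain ⟨hs1a, hs1x⟩ := hinv _ hq
  refine ⟨s₁, _, hq, tokenSystem_step_iff.2 (Or.inr ⟨a, b, htm⟩), hs1a, (hs1a.tokMove htm).2,
    fun x h1 h2 => by simp [hs1, h1, h2], hs1x, fun h => ?_, fun h => ?_⟩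
  · simpa [hne.symm] using (ha3 h).2
  · simpa using (hb3 h).2

end TokenSystem

/-! ## Types of vertices -/

/-- A classification of the vertices of topologies with `n` designated vertices. -/
abbrev VertexType (n : ℕ) (T : Type) : Type :=
  ∀ G : Topology, (Fin n → Fin G.size) → Fin G.size → T

/-- The designations of a vertex, and whether it has no outgoing edge. -/
def vertexLabel (n : ℕ) : VertexType n (Set (Fin n) × Prop) :=
  fun G g v => ({x | g x = v}, ∀ w, ¬ G.Edge v w)

section VertexType

variable {n : ℕ} {T T' : Type}

/-- An edge between vertices of the same type. -/
def ClassEdge (τ : VertexType n T) (G : Topology) (g : Fin n → Fin G.size)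
    (a b : Fin G.size) : Prop :=
  G.Edge a b ∧ τ G g b = τ G g a

/-- The `ρ`-types of the vertices that follow a walk from `v` inside its `τ`-class. -/
def exits (τ : VertexType n T) (ρ : VertexType n T') : VertexType n (Set T') :=
  fun G g v => {r | ∃ u w, Relation.ReflTransGen (ClassEdge τ G g) v u ∧ G.Edge u w ∧
    τ G g w ≠ τ G g u ∧ ρ G g w = r}

/-- There is an infinite walk from `v` inside its `τ`-class. -/
def Diverges (τ : VertexType n T) : VertexType n Prop :=
  fun G g v => ∃ p : ℕ → Fin G.size, p 0 = v ∧ ∀ i, ClassEdge τ G g (p i) (p (i + 1))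

/-- Values of the refinements of a classification with values in `T`. -/
def RefinedType (T : Type) : ℕ → Type
  | 0 => T
  | i + 1 => T × Set (RefinedType T i) × Prop

instance RefinedType.finite [Finite T] (i : ℕ) : Finite (RefinedType T i) := by
  induction i with
  | zero => exact ‹Finite T›
  | succ i ih => exact inferInstanceAs (Finite (T × Set (RefinedType T i) × Prop))

/-- The `i`-fold refinement of a classification records the sequences of at most `i` changes of
the type along the walks from a vertex, as a tree. -/
def refineType (τ : VertexType n T) : (i : ℕ) → VertexType n (RefinedType T i)
  | 0 => τ
  | i + 1 => fun G g v => (τ G g v, exits τ (refineType τ i) G g v, Diverges τ G g v)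

theorem eq_of_refine_eq {τ : VertexType n T} {G G' : Topology} {g : Fin n → Fin G.size}
    {g' : Fin n → Fin G'.size} {v : Fin G.size} {v' : Fin G'.size} {i : ℕ}
    (h : refineType τ i G g v = refineType τ i G' g' v') : τ G g v = τ G' g' v' := by
  cases i with
  | zero => exact h
  | succ i => exact congrArg Prod.fst h

/-- A bounded rank that decreases along edges to vertices that are not designated, strictly if the
type changes. -/
structure IsRanked (τ : VertexType n T) (rank : VertexType n ℕ) (R : ℕ) : Prop where
  label_eq : ∀ {G G' : Topology} {g : Fin n → Fin G.size} {g' : Fin n → Fin G'.size}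
    {v : Fin G.size} {v' : Fin G'.size}, τ G g v = τ G' g' v' →
    vertexLabel n G g v = vertexLabel n G' g' v'
  le_bound : ∀ G g v, rank G g v ≤ R
  mono : ∀ {G : Topology} {g : Fin n → Fin G.size} {u w : Fin G.size}, G.Edge u w →
    (∀ x, g x ≠ w) → rank G g w ≤ rank G g u
  strict : ∀ {G : Topology} {g : Fin n → Fin G.size} {u w : Fin G.size}, G.Edge u w →
    (∀ x, g x ≠ w) → τ G g w ≠ τ G g u → rank G g w < rank G g u

namespace IsRanked

variable {τ : VertexType n T} {rank : VertexType n ℕ} {R : ℕ}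

theorem apply_eq_iff (hτ : IsRanked τ rank R) {G G' : Topology} {g : Fin n → Fin G.size}
    {g' : Fin n → Fin G'.size} {v : Fin G.size} {v' : Fin G'.size}
    (h : τ G g v = τ G' g' v') (x : Fin n) : g x = v ↔ g' x = v' :=
  Set.ext_iff.1 (congrArg Prod.fst (hτ.label_eq h)) x

theorem forall_not_edge_iff (hτ : IsRanked τ rank R) {G G' : Topology} {g : Fin n → Fin G.size}
    {g' : Fin n → Fin G'.size} {v : Fin G.size} {v' : Fin G'.size}
    (h : τ G g v = τ G' g' v') : (∀ w, ¬ G.Edge v w) ↔ ∀ w, ¬ G'.Edge v' w :=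
  (congrArg Prod.snd (hτ.label_eq h)).to_iff

variable {G : Topology} {g : Fin n → Fin G.size} {a b : Fin G.size}

theorem ne_left (hτ : IsRanked τ rank R) (h : ClassEdge τ G g a b) (x : Fin n) : g x ≠ a := by
  intro hx
  have := (hτ.apply_eq_iff h.2 x).2 hx
  rw [hx] at this
  exact G.irrefl a (by simpa [← this] using h.1)

theorem ne_right (hτ : IsRanked τ rank R) (h : ClassEdge τ G g a b) (x : Fin n) : g x ≠ b :=
  fun hx => hτ.ne_left h x ((hτ.apply_eq_iff h.2 x).1 hx)

theorem rank_le (hτ : IsRanked τ rank R) (h : Relation.ReflTransGen (ClassEdge τ G g) a b) :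
    rank G g b ≤ rank G g a := by
  induction h with
  | refl => rfl
  | tail _ h ih => exact (hτ.mono h.1 (hτ.ne_right h)).trans ih

end IsRanked

variable {τ : VertexType n T} {G : Topology} {g : Fin n → Fin G.size} {a b : Fin G.size}

theorem eq_of_reflTransGen_classEdge (h : Relation.ReflTransGen (ClassEdge τ G g) a b) :
    τ G g b = τ G g a := by
  induction h with
  | refl => rfl
  | tail _ h ih => rw [h.2, ih]

theorem exits_subset {ρ : VertexType n T'} (h : Relation.ReflTransGen (ClassEdge τ G g) a b) :
    exits τ ρ G g b ⊆ exits τ ρ G g a := by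
  rintro r ⟨u, w, h1, h2⟩
  exact ⟨u, w, h.trans h1, h2⟩

theorem Diverges.of_reflTransGen (h : Relation.ReflTransGen (ClassEdge τ G g) a b)
    (hb : Diverges τ G g b) : Diverges τ G g a := by
  induction h using Relation.ReflTransGen.head_induction_on with
  | refl => exact hb
  | @head x _ h _ ih =>
    obtain ⟨p, rfl, hp⟩ := ih
    refine ⟨fun i => Nat.casesOn i x p, rfl, fun i => ?_⟩
    cases i with
    | zero => exact h
    | succ i => exact hp i

/-- The refinement of a ranked classification is ranked. -/
theorem IsRanked.refine [Finite T] {rank : VertexType n ℕ} {R : ℕ} (hτ : IsRanked τ rank R)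
    (i : ℕ) : ∃ rank' R', IsRanked (refineType τ (i + 1)) rank' R' := by
  classical
  set K := Nat.card (RefinedType T i) with hK
  set low : VertexType n ℕ := fun G g v =>
    rank G g v * (K + 2) + ((exits τ (refineType τ i) G g v).ncard +
      if Diverges τ G g v then 1 else 0) with hlow
  have hcard : ∀ G g v, (exits τ (refineType τ i) G g v).ncard +
      (if Diverges τ G g v then 1 else 0) < K + 2 := by
    intro G g v
    have h1 : (exits τ (refineType τ i) G g v).ncard ≤ K := by
      rw [hK, ← Set.ncard_univ]
      exact Set.ncard_le_ncard (Set.subset_univ _) (Set.toFinite _)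
    split_ifs <;> omega
  have hle : ∀ G g v, low G g v < (R + 1) * (K + 2) := by
    intro G g v
    have h1 := Nat.mul_le_mul_right (K + 2) (hτ.le_bound G g v)
    have h2 := hcard G g v
    rw [Nat.add_mul, Nat.one_mul]
    simp only [hlow]
    omega
  have key : ∀ {G : Topology} {g : Fin n → Fin G.size} {u w : Fin G.size}, G.Edge u w →
      (∀ x, g x ≠ w) → low G g w ≤ low G g u ∧
        (refineType τ (i + 1) G g w ≠ refineType τ (i + 1) G g u →
          low G g w < low G g u) := by
    intro G g u w he hw
    by_cases h : τ G g w = τ G g u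
    · have hce : Relation.ReflTransGen (ClassEdge τ G g) u w := .single ⟨he, h⟩
      have h1 := Nat.mul_le_mul_right (K + 2) (hτ.mono he hw)
      have h2 : exits τ (refineType τ i) G g w ⊆ exits τ (refineType τ i) G g u :=
        exits_subset hce
      have h3 := Set.ncard_le_ncard h2 (Set.toFinite _)
      have h4 : Diverges τ G g w → Diverges τ G g u := Diverges.of_reflTransGen hce
      refine ⟨?_, fun hne => ?_⟩
      · simp only [hlow]
        split_ifs with h5 h6 <;> first | omega | exact absurd (h4 h5) h6
      · by_cases h5 : exits τ (refineType τ i) G g w = exits τ (refineType τ i) G g u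
        · have h6 : ¬ (Diverges τ G g u → Diverges τ G g w) := fun h6 =>
            hne (Prod.ext h (Prod.ext h5 (propext ⟨h4, h6⟩)))
          push Not at h6
          simp only [hlow, h5, h6.1, h6.2, if_true, if_false]
          omega
        · have h6 := Set.ncard_lt_ncard (h2.ssubset_of_ne h5) (Set.toFinite _)
          simp only [hlow]
          split_ifs with h7 h8 <;> first | omega | exact absurd (h4 h7) h8
    · have h1 := Nat.mul_le_mul_right (K + 2) (hτ.strict he hw h)
      have h2 := hcard G g w
      have : low G g w < low G g u := by
        simp only [hlow]
        rw [Nat.succ_mul] at h1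
        omega
      exact ⟨this.le, fun _ => this⟩
  refine ⟨fun G g v => if ∃ x, g x = v then (R + 1) * (K + 2) else low G g v,
    (R + 1) * (K + 2), fun h => hτ.label_eq (eq_of_refine_eq h), fun G g v => ?_, ?_, ?_⟩
  · split_ifs
    · rfl
    · exact (hle _ _ _).le
  · intro G g u w he hw
    have hw' : ¬ ∃ x, g x = w := by simpa using hw
    simp only [hw', if_false]
    split_ifs
    · exact (hle _ _ _).le
    · exact (key he hw).1
  · intro G g u w he hw hne
    have hw' : ¬ ∃ x, g x = w := by simpa using hw
    simp only [hw', if_false]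
    split_ifs
    · exact hle _ _ _
    · exact (key he hw).2 hne

theorem isRanked_vertexLabel (n : ℕ) : ∃ rank R, IsRanked (vertexLabel n) rank R := by
  classical
  refine ⟨fun G g v => if ∃ x, g x = v then 2 else if ∀ w, ¬ G.Edge v w then 0 else 1, 2,
    fun h => h, fun G g v => ?_, ?_, ?_⟩
  · split_ifs <;> omega
  · intro G g u w he hw
    have hw' : ¬ ∃ x, g x = w := by simpa using hw
    have hu : ¬ ∀ w, ¬ G.Edge u w := fun h => h w he
    simp only [hw', hu, if_false]
    split_ifs <;> omega
  · intro G g u w he hw hne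
    have hw' : ¬ ∃ x, g x = w := by simpa using hw
    have hu : ¬ ∀ w, ¬ G.Edge u w := fun h => h w he
    simp only [hw', hu, if_false]
    by_cases h1 : ∃ x, g x = u
    · simp only [h1, if_true]
      split_ifs <;> omega
    by_cases h2 : ∀ v, ¬ G.Edge w v
    · simp [h1, h2]
    · refine absurd (Prod.ext (Set.ext fun x => ?_) ?_) hne
      · exact ⟨fun h => absurd h (hw x), fun h => absurd ⟨x, h⟩ h1⟩
      · simp only [vertexLabel, h2, hu]

end VertexType

/-! ## Matching paths of token-passing systems over different topologies -/

theorem exists_seq_of_transGen {α : Type*} {Q : α → Prop} {r : α → α → Prop}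
    (h : ∀ a, Q a → ∃ b, Relation.TransGen r a b ∧ Q b) {a : α} (ha : Q a) :
    ∃ p : ℕ → α, p 0 = a ∧ ∀ i, r (p i) (p (i + 1)) := by
  obtain ⟨p, h0, hp⟩ := exists_seq_of_forall_exists (r := r)
    (Q := fun a => ∃ b, Relation.TransGen r a b ∧ Q b) (fun a ⟨b, hab, hb⟩ => by
      rcases Relation.TransGen.head'_iff.1 hab with ⟨c, hac, hcb⟩
      refine ⟨c, hac, ?_⟩
      rcases Relation.reflTransGen_iff_eq_or_transGen.1 hcb with rfl | hcb
      · exact h _ hb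
      · exact ⟨b, hcb, hb⟩) (h a ha)
  exact ⟨p, h0, fun i => (hp i).1⟩

section Matching

variable {n : ℕ} {T : Type}

/-- What is observed of a global state: the type of the vertex with the token and the states of the
designated processes. -/
def observation (P : ProcessTemplate) (τ : VertexType n T) {G : Topology} (g : Fin n → Fin G.size)
    (s : Fin G.size → P.State) : Set T × (Fin n → P.State) :=
  ({c | ∃ v, HasTok P s v ∧ τ G g v = c}, fun x => s (g x))

/-- A step of a path that does not change the observation. -/
def ObsStep (κ : PathConvention) (P : ProcessTemplate) (τ : VertexType n T) {G : Topology}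
    (g : Fin n → Fin G.size) (s t : Fin G.size → P.State) : Prop :=
  (tokenSystem P G).PathStep κ s t ∧ observation P τ g t = observation P τ g s

variable {κ : PathConvention} {P : ProcessTemplate} {τ : VertexType n T} {G G' : Topology}
  {g : Fin n → Fin G.size} {g' : Fin n → Fin G'.size}

theorem HasTok.observation_eq {s : Fin G.size → P.State} {v : Fin G.size} (hs : HasTok P s v) :
    observation P τ g s = ({τ G g v}, fun x => s (g x)) := by
  refine Prod.ext (Set.ext fun c => ⟨?_, ?_⟩) rfl
  · rintro ⟨w, hw, rfl⟩
    rw [hw.unique hs]; rfl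
  · rintro rfl
    exact ⟨v, hs, rfl⟩

theorem HasTok.observation_eq_iff {s : Fin G.size → P.State} {s' : Fin G'.size → P.State}
    {v : Fin G.size} {v' : Fin G'.size} (hs : HasTok P s v) (hs' : HasTok P s' v') :
    observation P τ g s = observation P τ g' s' ↔
      τ G g v = τ G' g' v' ∧ ∀ x, s (g x) = s' (g' x) := by
  rw [hs.observation_eq, hs'.observation_eq, Prod.ext_iff, funext_iff]
  simp

theorem HasTok.reflTransGen_obsStep {s t : Fin G.size → P.State} {v : Fin G.size}
    (hs : HasTok P s v) (h : Relation.ReflTransGen (QuietStep P g) s t) :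
    Relation.ReflTransGen (ObsStep κ P τ g) s t := by
  suffices h' : Relation.ReflTransGen (ObsStep κ P τ g) s t ∧ HasTok P t v from h'.1
  induction h with
  | refl => exact ⟨.refl, hs⟩
  | tail _ h ih =>
    have ht := h.2.2 _ ih.2
    exact ⟨ih.1.tail ⟨Or.inl h.1, (ht.observation_eq_iff ih.2).2 ⟨rfl, h.2.1⟩⟩, ht⟩

theorem observation_eq_of_reflTransGen {s t : Fin G.size → P.State}
    (h : Relation.ReflTransGen (ObsStep κ P τ g) s t) :
    observation P τ g t = observation P τ g s := by
  induction h with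
  | refl => rfl
  | tail _ h ih => rw [h.2, ih]

variable {rank : VertexType n ℕ} {R : ℕ}

/-- The token can be moved inside a class without changing the observation. -/
theorem HasTok.exists_transGen_obsStep (hτ : IsRanked τ rank R) {s : Fin G.size → P.State}
    {a b : Fin G.size} (hs : HasTok P s a) (hab : ClassEdge τ G g a b) :
    ∃ t, Relation.TransGen (ObsStep κ P τ g) s t ∧ HasTok P t b := by
  have hna : ¬ ∃ x, g x = a := fun ⟨x, hx⟩ => hτ.ne_left hab x hx
  have hnb : ¬ ∃ x, g x = b := fun ⟨x, hx⟩ => hτ.ne_right hab x hx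
  obtain ⟨s₁, s₂, h1, h2, h3, h4, h5, h6, -⟩ := hs.exists_pass (g := g) hab.1 (qa := s a)
    (qb := s b) (fun h => absurd h hna) (fun h => absurd h hnb)
  refine ⟨s₂, Relation.TransGen.tail' (hs.reflTransGen_obsStep h1) ⟨Or.inl h2, ?_⟩, h4⟩
  refine (h4.observation_eq_iff h3).2 ⟨hab.2, fun x => ?_⟩
  rw [h6, h5 x (hτ.ne_left hab x) (hτ.ne_right hab x)]

theorem HasTok.exists_reflTransGen_obsStep (hτ : IsRanked τ rank R) {s : Fin G.size → P.State}
    {a b : Fin G.size} (hs : HasTok P s a) (hab : Relation.ReflTransGen (ClassEdge τ G g) a b) :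
    ∃ t, Relation.ReflTransGen (ObsStep κ P τ g) s t ∧ HasTok P t b := by
  induction hab with
  | refl => exact ⟨s, .refl, hs⟩
  | tail _ h ih =>
    obtain ⟨t, h1, h2⟩ := ih
    obtain ⟨u, h3, h4⟩ := h2.exists_transGen_obsStep (κ := κ) hτ h
    exact ⟨u, h1.trans h3.to_reflTransGen, h4⟩

/-- A step that keeps the observation moves the token along at most one edge of the class. -/
theorem HasTok.of_obsStep {s t : Fin G.size → P.State} {a : Fin G.size}
    (hs : HasTok P s a) (h : ObsStep κ P τ g s t) :
    ∃ b, HasTok P t b ∧ Relation.ReflTransGen (ClassEdge τ G g) a b := by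
  obtain ⟨h | ⟨-, -, rfl⟩, ho⟩ := h
  · obtain ⟨b, hb, rfl | hab⟩ := hs.step h
    · exact ⟨b, hb, .refl⟩
    · exact ⟨b, hb, .single ⟨hab, ((hb.observation_eq_iff hs).1 ho).1⟩⟩
  · exact ⟨a, hs, .refl⟩

theorem HasTok.along {π : ℕ → Fin G.size → P.State} {a : Fin G.size} {i j : ℕ} (hij : i ≤ j)
    (hπ : ∀ l, (tokenSystem P G).PathStep κ (π l) (π (l + 1)))
    (ho : ∀ l, i ≤ l → l ≤ j → observation P τ g (π l) = observation P τ g (π i))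
    (hs : HasTok P (π i) a) :
    ∃ b, HasTok P (π j) b ∧ Relation.ReflTransGen (ClassEdge τ G g) a b := by
  induction j, hij using Nat.le_induction with
  | base => exact ⟨a, hs, .refl⟩
  | succ j hij ih =>
    obtain ⟨b, hb, hab⟩ := ih fun l h1 h2 => ho l h1 (h2.trans (Nat.le_succ j))
    obtain ⟨c, hc, hbc⟩ := hb.of_obsStep (τ := τ) (g := g) (κ := κ) ⟨hπ j, by
      rw [ho (j + 1) (by omega) le_rfl, ho j hij (by omega)]⟩
    exact ⟨c, hc, hab.trans hbc⟩

theorem HasTok.exists_next {π : ℕ → Fin G.size → P.State} {a : Fin G.size} {i : ℕ}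
    (hπ : ∀ l, i ≤ l → (tokenSystem P G).Step (π l) (π (l + 1))) (hs : HasTok P (π i) a) :
    ∃ j, i ≤ j ∧ HasTok P (π j) a ∧ ∃ b, TokMove P a b (π j) (π (j + 1)) := by
  classical
  have hex : ∃ j, ∃ v w, TokMove P v w (π (i + j)) (π (i + j + 1)) := by
    obtain ⟨j, -, h⟩ := exists_tokMove (π := fun l => π (i + l)) (fun l => hπ _ (by omega)) 0
    exact ⟨j, h⟩
  have hspec := Nat.find_spec hex
  have hmin := @Nat.find_min _ _ hex
  generalize Nat.find hex = j at hspec hmin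
  have h : ∀ l, l ≤ j → HasTok P (π (i + l)) a := by
    intro l hl
    induction l with
    | zero => exact hs
    | succ l ih =>
      rcases tokenSystem_step_iff.1 (hπ (i + l) (by omega)) with ⟨z, hz⟩ | h
      · exact (ih (by omega)).intMove hz
      · exact absurd h (hmin (by omega))
  obtain ⟨v, w, hvw⟩ := hspec
  obtain ⟨rfl, -⟩ := (h j le_rfl).tokMove hvw
  exact ⟨i + j, by omega, h j le_rfl, w, hvw⟩

/-- A path with constant observation that does not end in a deadlock witnesses divergence. -/
theorem HasTok.diverges {π : ℕ → Fin G.size → P.State} {a : Fin G.size} {i : ℕ}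
    (hπ : ∀ l, i ≤ l → (tokenSystem P G).Step (π l) (π (l + 1)))
    (ho : ∀ l, i ≤ l → observation P τ g (π l) = observation P τ g (π i))
    (hs : HasTok P (π i) a) : Diverges τ G g a := by
  obtain ⟨p, h0, hp⟩ := exists_seq_of_forall_exists (r := ClassEdge τ G g)
    (Q := fun b => ∃ l, i ≤ l ∧ HasTok P (π l) b) (fun b ⟨l, hl, hb⟩ => by
      obtain ⟨j, hlj, hj, c, hc⟩ := hb.exists_next fun m hm => hπ m (hl.trans hm)
      have hc' := (hj.tokMove hc).2
      refine ⟨c, ⟨hc.1, ?_⟩, j + 1, by omega, hc'⟩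
      exact ((hc'.observation_eq_iff hj).1 (by rw [ho _ (by omega), ho j (by omega)])).1)
    (a := a) ⟨i, le_rfl, hs⟩
  exact ⟨p, h0, fun i => (hp i).1⟩

theorem HasTok.exists_path_of_diverges (hτ : IsRanked τ rank R) {s : Fin G.size → P.State}
    {a : Fin G.size} (hs : HasTok P s a) (ha : Diverges τ G g a) :
    ∃ p : ℕ → Fin G.size → P.State, p 0 = s ∧ ∀ i, ObsStep κ P τ g (p i) (p (i + 1)) := by
  refine exists_seq_of_transGen (Q := fun s => ∃ a, HasTok P s a ∧ Diverges τ G g a)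
    ?_ ⟨a, hs, ha⟩
  rintro s ⟨a, hs, p, rfl, hp⟩
  obtain ⟨t, h1, h2⟩ := hs.exists_transGen_obsStep (κ := κ) hτ (hp 0)
  exact ⟨t, h1, p 1, h2, fun i => p (i + 1), rfl, fun i => hp (i + 1)⟩

theorem HasTok.exists_path_of_deadlock {s : Fin G.size → P.State} {a : Fin G.size}
    (hs : HasTok P s a) (ha : ∀ w, ¬ G.Edge a w) (hx : ∀ x q, ¬ P.IntStep (s (g x)) q) :
    ∃ p : ℕ → Fin G.size → P.State, p 0 = s ∧ ∀ i, ObsStep .maximal P τ g (p i) (p (i + 1)) := by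
  obtain ⟨p, h0, hp⟩ := exists_seq_of_forall_exists (r := ObsStep .maximal P τ g)
    (Q := fun s => HasTok P s a ∧ ∀ x q, ¬ P.IntStep (s (g x)) q) (fun s ⟨hs, hx⟩ => by
      by_cases hd : ∃ t, (tokenSystem P G).Step s t
      · obtain ⟨t, ht⟩ := hd
        rcases tokenSystem_step_iff.1 ht with ⟨z, hz⟩ | ⟨v, w, hvw⟩
        · have htx : ∀ x, t (g x) = s (g x) := fun x => hz.2 _ fun e => hx x (t z) (by
            rw [e]; exact hz.1)
          have ht' := hs.intMove hz
          exact ⟨t, ⟨Or.inl ht, (ht'.observation_eq_iff hs).2 ⟨rfl, htx⟩⟩, ht', fun x q => by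
            rw [htx]; exact hx x q⟩
        · obtain ⟨rfl, -⟩ := hs.tokMove hvw
          exact absurd hvw.1 (ha w)
      · push Not at hd
        exact ⟨s, ⟨Or.inr ⟨rfl, hd, rfl⟩, rfl⟩, hs, hx⟩) (a := s) ⟨hs, hx⟩
  exact ⟨p, h0, fun i => (hp i).1⟩

/-- The vertex `v'` can simulate `v` for `b` changes of the type. -/
structure Below (τ : VertexType n T) (b : ℕ) {G G' : Topology} (g : Fin n → Fin G.size)
    (g' : Fin n → Fin G'.size) (v : Fin G.size) (v' : Fin G'.size) : Prop where
  type_eq : τ G g v = τ G' g' v'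
  exits_subset : exits τ (refineType τ b) G g v ⊆ exits τ (refineType τ b) G' g' v'
  diverges : Diverges τ G g v → Diverges τ G' g' v'

theorem Below.of_refineType_eq {b : ℕ} {v : Fin G.size} {v' : Fin G'.size}
    (h : refineType τ (b + 1) G g v = refineType τ (b + 1) G' g' v') : Below τ b g g' v v' where
  type_eq := congrArg Prod.fst h
  exits_subset := (congrArg (fun r => r.2.1) h).subset
  diverges := (congrArg (fun r => r.2.2) h).mp

theorem Below.of_reflTransGen {b : ℕ} {v w : Fin G.size} {v' : Fin G'.size}
    (h : Below τ b g g' v v') (hvw : Relation.ReflTransGen (ClassEdge τ G g) v w) :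
    Below τ b g g' w v' where
  type_eq := (eq_of_reflTransGen_classEdge hvw).trans h.type_eq
  exits_subset := (_root_.exits_subset hvw).trans h.exits_subset
  diverges hw := h.diverges (hw.of_reflTransGen hvw)

/-- The invariant of the construction of a matching path. -/
def Simulates (P : ProcessTemplate) (τ : VertexType n T) (rank : VertexType n ℕ)
    (g : Fin n → Fin G.size) (g' : Fin n → Fin G'.size) (s : Fin G.size → P.State)
    (s' : Fin G'.size → P.State) : Prop :=
  ∃ v v' b, HasTok P s v ∧ HasTok P s' v' ∧ (∀ x, s (g x) = s' (g' x)) ∧ rank G g v ≤ b ∧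
    Below τ b g g' v v'

theorem Simulates.observation_eq {s : Fin G.size → P.State} {s' : Fin G'.size → P.State}
    (h : Simulates P τ rank g g' s s') : observation P τ g s = observation P τ g' s' := by
  obtain ⟨v, v', b, h1, h2, h3, h4, h5⟩ := h
  exact (h1.observation_eq_iff h2).2 ⟨h5.type_eq, h3⟩

/-- A path with constant observation is matched by one with constant observation. -/
theorem Simulates.exists_path (hτ : IsRanked τ rank R) {π : ℕ → Fin G.size → P.State}
    {s' : Fin G'.size → P.State} {i : ℕ}
    (hπ : ∀ l, (tokenSystem P G).PathStep κ (π l) (π (l + 1)))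
    (ho : ∀ l, i ≤ l → observation P τ g (π l) = observation P τ g (π i))
    (h : Simulates P τ rank g g' (π i) s') :
    ∃ p : ℕ → Fin G'.size → P.State, p 0 = s' ∧ ∀ l, ObsStep κ P τ g' (p l) (p (l + 1)) := by
  obtain ⟨v, v', b, h1, h2, h3, h4, h5⟩ := h
  by_cases hd : ∃ l, i ≤ l ∧ ¬ (tokenSystem P G).Step (π l) (π (l + 1))
  · obtain ⟨l, hil, hl⟩ := hd
    obtain ⟨rfl, hdead, -⟩ := (hπ l).resolve_left hl
    obtain ⟨w, hw, hvw⟩ := h1.along hil hπ fun m hm _ => ho m hm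
    obtain ⟨hw1, hw2⟩ := hw.deadlock hdead
    have hx := ((hw.observation_eq_iff h1).1 (ho l hil)).2
    refine h2.exists_path_of_deadlock
      ((hτ.forall_not_edge_iff (g := g) (g' := g') ?_).1 hw1) fun x q => ?_
    · rw [eq_of_reflTransGen_classEdge hvw, h5.type_eq]
    · rw [← h3, ← hx]
      exact hw2 _ q
  · push Not at hd
    exact h2.exists_path_of_diverges hτ (h5.diverges (h1.diverges hd ho))

/-- A change of the observation is matched, after steps that keep it. -/
theorem Simulates.exists_step (hτ : IsRanked τ rank R)
    (hg : ∀ x, refineType τ (R + 1) G g (g x) = refineType τ (R + 1) G' g' (g' x))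
    {π : ℕ → Fin G.size → P.State} {s' : Fin G'.size → P.State} {i m : ℕ} (him : i ≤ m)
    (hπ : ∀ l, (tokenSystem P G).PathStep κ (π l) (π (l + 1)))
    (ho : ∀ l, i ≤ l → l ≤ m → observation P τ g (π l) = observation P τ g (π i))
    (hm : observation P τ g (π (m + 1)) ≠ observation P τ g (π i))
    (h : Simulates P τ rank g g' (π i) s') :
    ∃ s₁ s₂, Relation.ReflTransGen (ObsStep κ P τ g') s' s₁ ∧
      (tokenSystem P G').PathStep κ s₁ s₂ ∧ Simulates P τ rank g g' (π (m + 1)) s₂ := by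
  obtain ⟨v, v', b, h1, h2, h3, h4, h5⟩ := h
  rw [← ho m him le_rfl] at hm
  obtain ⟨a, ha, hva⟩ := h1.along him hπ ho
  have hx := ((ha.observation_eq_iff h1).1 (ho m him le_rfl)).2
  have hrank := (hτ.rank_le hva).trans h4
  have h6 := h5.of_reflTransGen hva
  rcases hπ m with hstep | ⟨-, -, he⟩
  swap
  · rw [he] at hm; exact absurd rfl hm
  rcases tokenSystem_step_iff.1 hstep with ⟨z, hz⟩ | ⟨a', c, hac⟩
  · have ha' := ha.intMove hz
    by_cases hzw : ∃ x, g x = z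
    · obtain ⟨x, rfl⟩ := hzw
      have hmove : IntMove P (g' x) s' (Function.update s' (g' x) (π (m + 1) (g x))) := by
        refine ⟨?_, fun w hw => by simp [hw]⟩
        rw [Function.update_self, ← h3, ← hx]
        exact hz.1
      refine ⟨s', _, .refl, Or.inl (tokenSystem_step_iff.2 (Or.inl ⟨_, hmove⟩)),
        a, v', b, ha', h2.intMove hmove, fun y => ?_, hrank, h6⟩
      by_cases hy : g y = g x
      · rw [(hτ.apply_eq_iff (eq_of_refine_eq (hg x)) y).1 hy, hy, Function.update_self]
      · rw [hz.2 _ hy, hx, h3, Function.update_of_ne]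
        exact fun e => hy ((hτ.apply_eq_iff (eq_of_refine_eq (hg x)) y).2 e)
    · exact absurd ((ha'.observation_eq_iff ha).2
        ⟨rfl, fun x => hz.2 _ fun e => hzw ⟨x, e⟩⟩) hm
  · obtain ⟨rfl, hc⟩ := ha.tokMove hac
    have hne : τ G g c ≠ τ G g a' := by
      intro he
      have hce : ClassEdge τ G g a' c := ⟨hac.1, he⟩
      exact hm ((hc.observation_eq_iff ha).2 ⟨he, fun x =>
        hac.2.2.2 _ (hτ.ne_left hce x) (hτ.ne_right hce x)⟩)
    obtain ⟨u, w, hu, huw, hne', hwc⟩ := h6.exits_subset ⟨a', c, .refl, hac.1, hne, rfl⟩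
    have hτu : τ G g a' = τ G' g' u := by rw [eq_of_reflTransGen_classEdge hu, h6.type_eq]
    have hτw : τ G g c = τ G' g' w := (eq_of_refine_eq hwc).symm
    obtain ⟨t, ht, htu⟩ := h2.exists_reflTransGen_obsStep (κ := κ) hτ hu
    have htx : ∀ x, t (g' x) = π m (g x) := fun x => by
      rw [((htu.observation_eq_iff h2).1 (observation_eq_of_reflTransGen ht)).2, ← h3, hx]
    obtain ⟨s₁, s₂, e1, e2, e3, e4, e5, e6, e7, e8⟩ := htu.exists_pass (g := g') huw
      (qa := π (m + 1) a') (qb := π (m + 1) c)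
      (fun ⟨x, hxu⟩ => by
        rw [← hxu, htx, (hτ.apply_eq_iff hτu x).2 hxu]; exact hac.2.1)
      (fun ⟨x, hxu⟩ => by
        rw [← hxu, htx, (hτ.apply_eq_iff hτw x).2 hxu]; exact hac.2.2.1)
    have hwatch : ∀ x, π (m + 1) (g x) = s₂ (g' x) := by
      intro x
      by_cases hxa : g x = a'
      · have := (hτ.apply_eq_iff hτu x).1 hxa
        rw [hxa, this, e7 ⟨x, this⟩]
      by_cases hxc : g x = c
      · have := (hτ.apply_eq_iff hτw x).1 hxc
        rw [hxc, this, e8 ⟨x, this⟩]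
      rw [hac.2.2.2 _ hxa hxc, e5 x (fun e => hxa ((hτ.apply_eq_iff hτu x).2 e))
        (fun e => hxc ((hτ.apply_eq_iff hτw x).2 e)), htx]
    refine ⟨s₁, s₂, ht.trans (htu.reflTransGen_obsStep e1), Or.inl e2, c, w, ?_⟩
    by_cases hcw : ∃ x, g x = c
    · obtain ⟨x, rfl⟩ := hcw
      have hw : g' x = w := (hτ.apply_eq_iff hτw x).1 rfl
      refine ⟨R, hc, e4, hwatch, hτ.le_bound _ _ _, ?_⟩
      rw [← hw]
      exact Below.of_refineType_eq (hg x)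
    · have hlt := hτ.strict hac.1 (fun x hx => hcw ⟨x, hx⟩) hne
      obtain ⟨b, rfl⟩ : ∃ b', b = b' + 1 := ⟨b - 1, by omega⟩
      exact ⟨b, hc, e4, hwatch, by omega, Below.of_refineType_eq hwc.symm⟩

/-- Every path is matched by a path over the other topology. -/
theorem exists_matching_path (hτ : IsRanked τ rank R)
    (hg : ∀ x, refineType τ (R + 1) G g (g x) = refineType τ (R + 1) G' g' (g' x))
    {s : Fin G.size → P.State} {s' : Fin G'.size → P.State} {v : Fin G.size} {v' : Fin G'.size}
    (hs : HasTok P s v) (hs' : HasTok P s' v')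
    (hv : refineType τ (R + 1) G g v = refineType τ (R + 1) G' g' v')
    (hx : ∀ x, s (g x) = s' (g' x)) {π : ℕ → Fin G.size → P.State} (h0 : π 0 = s)
    (hπ : ∀ l, (tokenSystem P G).PathStep κ (π l) (π (l + 1))) :
    ∃ π' : ℕ → Fin G'.size → P.State, π' 0 = s' ∧
      (∀ l, (tokenSystem P G').PathStep κ (π' l) (π' (l + 1))) ∧
      StutterEquiv (fun i => observation P τ g (π i)) (fun t => observation P τ g' (π' t)) := by
  refine exists_path_stutterEquiv (Inv := fun i s' => Simulates P τ rank g g' (π i) s') ?_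
    ⟨v, v', R, by rwa [h0], hs', by rwa [h0], hτ.le_bound _ _ _, Below.of_refineType_eq hv⟩
  intro i t hit
  refine ⟨hit.observation_eq.symm, ?_⟩
  by_cases hc : ∃ l, observation P τ g (π (i + l + 1)) ≠ observation P τ g (π i)
  · classical
    have hspec := Nat.find_spec hc
    have hmin := @Nat.find_min _ _ hc
    generalize Nat.find hc = m at hspec hmin
    have hmin' : ∀ l, i ≤ l → l ≤ i + m →
        observation P τ g (π l) = observation P τ g (π i) := by
      intro l hil hlm
      rcases hil.eq_or_lt with rfl | hlt
      · rfl
      · have := hmin (show l - i - 1 < m by omega)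
        rw [show i + (l - i - 1) + 1 = l by omega] at this
        exact not_not.1 this
    obtain ⟨s₁, s₂, h1, h2, h3⟩ := hit.exists_step hτ hg (Nat.le_add_right i m) hπ hmin' hspec
    exact Or.inl ⟨i + m + 1, by omega, fun l hl hl' => hmin' l hl (by omega), s₁, s₂, h1, h2, h3⟩
  · push Not at hc
    have hcon : ∀ l, i ≤ l → observation P τ g (π l) = observation P τ g (π i) := by
      intro l hil
      rcases hil.eq_or_lt with rfl | hlt
      · rfl
      · have := hc (l - i - 1)
        rwa [show i + (l - i - 1) + 1 = l by omega] at this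
    obtain ⟨p, hp0, hp⟩ := hit.exists_path hτ hπ hcon
    refine Or.inr ⟨hcon, p, hp0, fun l => ⟨(hp l).1, ?_⟩⟩
    induction l with
    | zero => rw [hp0]
    | succ l ih => rw [(hp l).2, ih]

end Matching

/-! ## Finitely many topologies up to bounded-depth equivalence -/

/-- The token-passing system in which only the processes at the vertices `g` are observed. -/
abbrev observedSystem (P : ProcessTemplate) (G : Topology) {n : ℕ} (g : Fin n → Fin G.size) :
    LTS (SysLabel P.Act) (ℕ × Fin n) :=
  (tokenSystem P G).relabel fun a => (a.1, g a.2)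

section

variable {n : ℕ} {T : Type}

/-- States with equally typed tokens and equal observed processes satisfy the same formulas of
depth at most `d`. -/
def DeterminesDepth (κ : PathConvention) (τ : VertexType n T) (d : ℕ) : Prop :=
  ∀ (P : ProcessTemplate) (G G' : Topology) (g : Fin n → Fin G.size) (g' : Fin n → Fin G'.size)
    (s : Fin G.size → P.State) (s' : Fin G'.size → P.State) (v : Fin G.size) (v' : Fin G'.size),
    (∀ x, τ G g (g x) = τ G' g' (g' x)) → HasTok P s v → HasTok P s' v' →
    τ G g v = τ G' g' v' → (∀ x, s (g x) = s' (g' x)) →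
    ∀ φ : StateFormula (ℕ × Fin n), φ.depth ≤ d →
      (φ.Sat κ (observedSystem P G g) s ↔ φ.Sat κ (observedSystem P G' g') s')

theorem StateFormula.sat_iff_of_ex {A A' AP : Type} {κ : PathConvention} {M : LTS A AP}
    {N : LTS A' AP} {d : ℕ} {s : M.State} {s' : N.State} (hl : M.label s = N.label s')
    (h : ∀ ψ : PathFormula AP, (StateFormula.ex ψ).depth ≤ d →
      ((StateFormula.ex ψ).Sat κ M s ↔ (StateFormula.ex ψ).Sat κ N s')) :
    ∀ φ : StateFormula AP, φ.depth ≤ d → (φ.Sat κ M s ↔ φ.Sat κ N s')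
  | .tru, _ => by simp [StateFormula.Sat]
  | .atom a, _ => by simp [StateFormula.Sat, hl]
  | .neg φ, hd => by
      have := StateFormula.sat_iff_of_ex hl h φ (by simpa [StateFormula.depth] using hd)
      simp only [StateFormula.Sat, this]
  | .and φ χ, hd => by
      simp only [StateFormula.depth, max_le_iff] at hd
      have h1 := StateFormula.sat_iff_of_ex hl h φ hd.1
      have h2 := StateFormula.sat_iff_of_ex hl h χ hd.2
      simp only [StateFormula.Sat, h1, h2]
  | .ex ψ, hd => h ψ hd

theorem label_observedSystem_eq {P : ProcessTemplate} {G G' : Topology} {g : Fin n → Fin G.size}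
    {g' : Fin n → Fin G'.size} {s : Fin G.size → P.State} {s' : Fin G'.size → P.State}
    (hx : ∀ x, s (g x) = s' (g' x)) :
    (observedSystem P G g).label s = (observedSystem P G' g').label s' := by
  ext a
  show a.1 ∈ P.label (s (g a.2)) ↔ a.1 ∈ P.label (s' (g' a.2))
  rw [hx]

theorem DeterminesDepth.zero (κ : PathConvention) (τ : VertexType n T) :
    DeterminesDepth κ τ 0 := by
  intro P G G' g g' s s' v v' _ _ _ _ hx
  exact StateFormula.sat_iff_of_ex (label_observedSystem_eq hx)
    fun ψ hψ => by simp [StateFormula.depth] at hψ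

theorem HasTok.exists_of_path {κ : PathConvention} {P : ProcessTemplate} {G : Topology}
    {π : ℕ → Fin G.size → P.State} {v : Fin G.size} (hs : HasTok P (π 0) v)
    (hπ : ∀ l, (tokenSystem P G).PathStep κ (π l) (π (l + 1))) (i : ℕ) :
    ∃ w, HasTok P (π i) w := by
  induction i with
  | zero => exact ⟨v, hs⟩
  | succ i ih =>
    obtain ⟨w, hw⟩ := ih
    rcases hπ i with h | ⟨-, -, h⟩
    · obtain ⟨u, hu, -⟩ := hw.step h
      exact ⟨u, hu⟩
    · exact ⟨w, by rwa [h]⟩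

theorem DeterminesDepth.succ {κ : PathConvention} {τ : VertexType n T} {rank : VertexType n ℕ}
    {R d : ℕ} (hτ : IsRanked τ rank R) (h : DeterminesDepth κ τ d) :
    DeterminesDepth κ (refineType τ (R + 1)) (d + 1) := by
  have key : ∀ (P : ProcessTemplate) (G G' : Topology) (g : Fin n → Fin G.size)
      (g' : Fin n → Fin G'.size) (s : Fin G.size → P.State) (s' : Fin G'.size → P.State)
      (v : Fin G.size) (v' : Fin G'.size),
      (∀ x, refineType τ (R + 1) G g (g x) = refineType τ (R + 1) G' g' (g' x)) →
      HasTok P s v → HasTok P s' v' →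
      refineType τ (R + 1) G g v = refineType τ (R + 1) G' g' v' → (∀ x, s (g x) = s' (g' x)) →
      ∀ ψ : PathFormula (ℕ × Fin n), ψ.depth ≤ d →
        (StateFormula.ex ψ).Sat κ (observedSystem P G g) s →
        (StateFormula.ex ψ).Sat κ (observedSystem P G' g') s' := by
    intro P G G' g g' s s' v v' hg hs hs' hv hx ψ hψ hsat
    obtain ⟨π, hπ, h0, hsat⟩ := hsat
    rw [LTS.isPath_iff] at hπ
    obtain ⟨π', h0', hπ', Z, hZ, hobs⟩ := exists_matching_path hτ hg hs hs' hv hx h0 hπ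
    have htok := HasTok.exists_of_path (P := P) (π := π) (by rw [h0]; exact hs) hπ
    have htok' := HasTok.exists_of_path (P := P) (π := π') (by rw [h0']; exact hs') hπ'
    refine ⟨π', LTS.isPath_iff.2 hπ', h0', ?_⟩
    have := PathFormula.sat_iff_of_zigZag (M := observedSystem P G g)
      (N := observedSystem P G' g') (κ := κ) (π := π) (π' := π') (d := d) hZ (fun i t hit => by
        obtain ⟨w, hw⟩ := htok i
        obtain ⟨w', hw'⟩ := htok' t
        obtain ⟨h1, h2⟩ := (hw.observation_eq_iff hw').1 (hobs i t hit)
        exact h P G G' g g' (π i) (π' t) w w' (fun x => eq_of_refine_eq (hg x)) hw hw' h1 h2)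
      ψ hψ 0 0 hZ.zero
    simp only [Nat.zero_add] at this
    exact this.1 hsat
  intro P G G' g g' s s' v v' hg hs hs' hv hx
  refine StateFormula.sat_iff_of_ex (label_observedSystem_eq hx) fun ψ hψ => ?_
  have hψ' : ψ.depth ≤ d := by simpa [StateFormula.depth] using hψ
  exact ⟨key P G G' g g' s s' v v' hg hs hs' hv hx ψ hψ',
    key P G' G g' g s' s v' v (fun x => (hg x).symm) hs' hs hv.symm (fun x => (hx x).symm) ψ hψ'⟩

theorem exists_determinesDepth (κ : PathConvention) (n d : ℕ) :
    ∃ (T : Type) (_ : Finite T) (τ : VertexType n T) (rank : VertexType n ℕ) (R : ℕ),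
      IsRanked τ rank R ∧ DeterminesDepth κ τ d := by
  induction d with
  | zero =>
    obtain ⟨rank, R, h⟩ := isRanked_vertexLabel n
    exact ⟨_, inferInstance, vertexLabel n, rank, R, h, .zero κ _⟩
  | succ d ih =>
    obtain ⟨T, _, τ, rank, R, h1, h2⟩ := ih
    obtain ⟨rank', R', h3⟩ := h1.refine R
    exact ⟨_, inferInstance, refineType τ (R + 1), rank', R', h3, h2.succ h1⟩

theorem exists_finite_matrix (κ : PathConvention) (n d : ℕ) :
    ∃ (T : Type) (_ : Finite T) (β : ∀ G : Topology, (Fin n → Fin G.size) → T),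
      ∀ (G G' : Topology) (g : Fin n → Fin G.size) (g' : Fin n → Fin G'.size), β G g = β G' g' →
        ∀ (P : ProcessTemplate) (φ : StateFormula (ℕ × Fin n)), φ.depth ≤ d →
          ((observedSystem P G g).Models κ φ ↔ (observedSystem P G' g').Models κ φ) := by
  obtain ⟨T, _, τ, rank, R, h1, h2⟩ := exists_determinesDepth κ n d
  refine ⟨T × (Fin n → T), inferInstance, fun G g => (τ G g G.start, fun x => τ G g (g x)), ?_⟩
  intro G G' g g' h P φ hφ
  have hstart := congrArg Prod.fst h
  have hg := congrFun (congrArg Prod.snd h)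
  have htok : ∀ G : Topology, HasTok P (fun v => if v = G.start then P.initTok else P.initNon)
      G.start := by
    intro G w
    by_cases hw : w = G.start
    · simp [hw, P.initTok_mem]
    · simp [hw, P.initNon_notMem]
  have := h2 P G G' g g' _ _ _ _ hg (htok G) (htok G') hstart (fun x => by
    have := h1.apply_eq_iff hstart x
    by_cases hx : g x = G.start
    · simp [hx, this.1 hx]
    · have hx' : g' x ≠ G'.start := fun e => hx (this.2 e)
      simp [hx, hx']) φ hφ
  constructor
  · rintro hm s rfl
    exact this.1 (hm _ rfl)
  · rintro hm s rfl
    exact this.2 (hm _ rfl)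

instance IndexRange.finite (n : ℕ) : Finite (IndexRange n) := by
  refine Finite.of_injective (β := Unit ⊕ Finset (Fin n) ⊕ Fin n) (fun
    | .univ => .inl ()
    | .among Y => .inr (.inl Y)
    | .succ y => .inr (.inr y)) ?_
  rintro (_ | Y | y) (_ | Y' | y') h <;> simp_all

theorem exists_finite_prenex (κ : PathConvention) (k d n : ℕ) :
    ∃ (T : Type) (_ : Finite T) (β : ∀ G : Topology, (Fin n → Fin G.size) → T),
      ∀ (G G' : Topology) (g : Fin n → Fin G.size) (g' : Fin n → Fin G'.size), β G g = β G' g' →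
        ∀ (P : ProcessTemplate) (Φ : Prenex n k), Φ.depth ≤ d →
          (Φ.Holds κ P G g ↔ Φ.Holds κ P G' g') := by
  induction k generalizing n with
  | zero =>
    obtain ⟨T, hT, β, h⟩ := exists_finite_matrix κ n d
    refine ⟨T, hT, β, fun G G' g g' hβ P Φ hΦ => ?_⟩
    cases Φ with
    | matrix φ => exact h G G' g g' hβ P φ hΦ
  | succ k ih =>
    obtain ⟨T, hT, β, h⟩ := ih (n + 1)
    refine ⟨Set (Set (IndexRange n) × T), inferInstance, fun G g =>
      Set.range fun v => ({r | r.Mem G g v}, β G (Fin.snoc g v)), fun G G' g g' hβ P Φ hΦ => ?_⟩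
    have h1 : ∀ v, ∃ v', (∀ r : IndexRange n, r.Mem G' g' v' ↔ r.Mem G g v) ∧
        β G' (Fin.snoc g' v') = β G (Fin.snoc g v) := by
      intro v
      obtain ⟨v', hv'⟩ := hβ.subset ⟨v, rfl⟩
      exact ⟨v', Set.ext_iff.1 (congrArg Prod.fst hv'), congrArg Prod.snd hv'⟩
    have h2 : ∀ v', ∃ v, (∀ r : IndexRange n, r.Mem G g v ↔ r.Mem G' g' v') ∧
        β G (Fin.snoc g v) = β G' (Fin.snoc g' v') := by
      intro v'
      obtain ⟨v, hv⟩ := hβ.superset ⟨v', rfl⟩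
      exact ⟨v, Set.ext_iff.1 (congrArg Prod.fst hv), congrArg Prod.snd hv⟩
    cases Φ with
    | all r Φ =>
      simp only [Prenex.Holds]
      constructor
      · intro hall v' hv'
        obtain ⟨v, hr, hv⟩ := h2 v'
        exact (h _ _ _ _ hv P Φ hΦ).1 (hall v ((hr r).2 hv'))
      · intro hall v hv
        obtain ⟨v', hr, hv'⟩ := h1 v
        exact (h _ _ _ _ hv' P Φ hΦ).1 (hall v' ((hr r).2 hv))
    | ex r Φ =>
      simp only [Prenex.Holds]
      constructor
      · rintro ⟨v, hv, hh⟩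
        obtain ⟨v', hr, hv'⟩ := h1 v
        exact ⟨v', (hr r).2 hv, (h _ _ _ _ hv' P Φ hΦ).2 hh⟩
      · rintro ⟨v', hv', hh⟩
        obtain ⟨v, hr, hv⟩ := h2 v'
        exact ⟨v, (hr r).2 hv', (h _ _ _ _ hv P Φ hΦ).2 hh⟩

end

theorem exists_isCutoff (κ : PathConvention) (𝒢 : Set Topology) (k d : ℕ) :
    ∃ c, IsCutoff κ 𝒢 (boundedDepth k d) c := by
  obtain ⟨T, hT, β, h⟩ := exists_finite_prenex κ k d 0
  have : ∀ b : T, ∃ c : ℕ, (∃ G ∈ 𝒢, β G Fin.elim0 = b) →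
      ∃ G ∈ 𝒢, β G Fin.elim0 = b ∧ G.size ≤ c := by
    intro b
    by_cases hb : ∃ G ∈ 𝒢, β G Fin.elim0 = b
    · obtain ⟨G, hG, hGb⟩ := hb
      exact ⟨G.size, fun _ => ⟨G, hG, hGb, le_rfl⟩⟩
    · exact ⟨0, fun h => absurd h hb⟩
  choose c hc using this
  obtain ⟨C, hC⟩ := (Set.finite_range c).bddAbove
  refine ⟨C, fun P Φ hΦ => ⟨fun hall G hG => ?_, fun hall G hG _ => hall G hG⟩⟩
  obtain ⟨G', hG', hβ, hle⟩ := hc _ ⟨G, hG, rfl⟩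
  exact (h G' G _ _ hβ P Φ hΦ).1 (hall G' hG' (hle.trans (hC ⟨_, rfl⟩)))

/-! ## Ultimately periodic sequences -/

/-- The pair `(u, v)` stands for the ultimately periodic word `u v v v …`. -/
abbrev Lasso (α : Type) : Type := List α × List α

namespace Lasso

variable {α β : Type}

/-- Removal of the first letter. -/
def tail : Lasso α → Lasso α
  | ([], []) => ([], [])
  | ([], a :: v) => ([], v ++ [a])
  | (_ :: u, v) => (u, v)

/-- The first letter. -/
def head [Inhabited α] (l : Lasso α) : α := (l.1 ++ l.2).headI

/-- The word that a lasso stands for. -/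
def seq [Inhabited α] (l : Lasso α) (i : ℕ) : α := head (tail^[i] l)

theorem seq_zero [Inhabited α] (l : Lasso α) : l.seq 0 = l.head := rfl

theorem seq_iterate_tail [Inhabited α] (l : Lasso α) (i j : ℕ) :
    seq (tail^[i] l) j = l.seq (i + j) := by
  rw [seq, seq, ← Function.iterate_add_apply, Nat.add_comm]

theorem tail_snd_ne_nil {l : Lasso α} (h : l.2 ≠ []) : l.tail.2 ≠ [] := by
  obtain ⟨_ | ⟨a, u⟩, _ | ⟨b, v⟩⟩ := l <;> simp_all [tail]

theorem mem_tail_snd {l : Lasso α} {x : α} (h : x ∈ l.2) : x ∈ l.tail.2 := by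
  obtain ⟨_ | ⟨a, u⟩, _ | ⟨b, v⟩⟩ := l <;> simp_all [tail, or_comm]

theorem mem_iterate_tail_snd {l : Lasso α} {x : α} (h : x ∈ l.2) (i : ℕ) :
    x ∈ (tail^[i] l).2 := by
  induction i with
  | zero => exact h
  | succ i ih => rw [Function.iterate_succ_apply']; exact mem_tail_snd ih

theorem exists_seq_eq_of_mem [Inhabited α] {l : Lasso α} {x : α} (h : x ∈ l.2) :
    ∃ j, l.seq j = x := by
  obtain ⟨u, v⟩ := l
  induction u with
  | nil =>
    obtain ⟨a, b, rfl⟩ := List.append_of_mem h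
    clear h
    induction a generalizing b with
    | nil => exact ⟨0, rfl⟩
    | cons c a ih =>
      obtain ⟨j, hj⟩ := ih (b ++ [c])
      refine ⟨j + 1, ?_⟩
      rw [Nat.add_comm, ← seq_iterate_tail]
      simpa [tail] using hj
  | cons c u ih =>
    obtain ⟨j, hj⟩ := ih h
    refine ⟨j + 1, ?_⟩
    rw [Nat.add_comm, ← seq_iterate_tail]
    simpa [tail] using hj

theorem exists_le_seq_eq_of_mem [Inhabited α] {l : Lasso α} {x : α} (h : x ∈ l.2) (i : ℕ) :
    ∃ j, i ≤ j ∧ l.seq j = x := by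
  obtain ⟨j, hj⟩ := exists_seq_eq_of_mem (mem_iterate_tail_snd h i)
  exact ⟨i + j, by omega, by rw [← seq_iterate_tail, hj]⟩

/-- Successive letters are related, also at the closing of the loop. -/
def IsClosed [Inhabited α] (R : α → α → Prop) (l : Lasso α) : Prop :=
  l.2 ≠ [] ∧ List.IsChain R (l.1 ++ l.2 ++ [l.2.headI])

theorem IsClosed.tail [Inhabited α] {R : α → α → Prop} {l : Lasso α} (h : l.IsClosed R) :
    l.tail.IsClosed R ∧ R l.head l.tail.head := by
  obtain ⟨_ | ⟨a, u⟩, _ | ⟨b, v⟩⟩ := l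
  · exact absurd rfl h.1
  · obtain ⟨-, h⟩ := h
    cases v with
    | nil => simpa [IsClosed, Lasso.tail, head] using h
    | cons c v =>
      simp only [List.nil_append, List.headI_cons, List.cons_append, List.isChain_cons_cons] at h
      refine ⟨⟨by simp [Lasso.tail], ?_⟩, by simpa [Lasso.tail, head] using h.1⟩
      have h2 : List.IsChain R ((c :: (v ++ [b])) ++ [c]) := by
        rw [List.isChain_append]
        refine ⟨h.2, by simp, fun x hx y hy => ?_⟩
        rw [← List.cons_append, List.getLast?_concat] at hx
        obtain rfl : b = x := by simpa using hx
        obtain rfl : c = y := by simpa using hy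
        exact h.1
      simpa [Lasso.tail] using h2
  · exact absurd rfl h.1
  · obtain ⟨-, h⟩ := h
    simp only [List.cons_append] at h
    refine ⟨⟨by simp [Lasso.tail], ?_⟩, ?_⟩
    · simpa [Lasso.tail] using h.tail
    · cases u with
      | nil => simpa [Lasso.tail, head] using (List.isChain_cons_cons.1 h).1
      | cons c u => simpa [Lasso.tail, head] using (List.isChain_cons_cons.1 h).1

theorem IsClosed.seq_rel [Inhabited α] {R : α → α → Prop} {l : Lasso α} (h : l.IsClosed R)
    (i : ℕ) : R (l.seq i) (l.seq (i + 1)) := by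
  have : ∀ i, IsClosed R (Lasso.tail^[i] l) := by
    intro i
    induction i with
    | zero => exact h
    | succ i ih => rw [Function.iterate_succ_apply']; exact ih.tail.1
  simp only [seq, Function.iterate_succ_apply']
  exact (this i).tail.2

/-- Letterwise image. -/
def map (f : α → β) (l : Lasso α) : Lasso β := (l.1.map f, l.2.map f)

theorem tail_map (f : α → β) (l : Lasso α) : (l.map f).tail = l.tail.map f := by
  obtain ⟨_ | ⟨a, u⟩, _ | ⟨b, v⟩⟩ := l <;> simp [tail, map]

theorem head_map [Inhabited α] [Inhabited β] (f : α → β) {l : Lasso α} (h : l.2 ≠ []) :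
    (l.map f).head = f l.head := by
  obtain ⟨_ | ⟨a, u⟩, _ | ⟨b, v⟩⟩ := l <;> simp_all [head, map]

theorem seq_map [Inhabited α] [Inhabited β] (f : α → β) {l : Lasso α} (h : l.2 ≠ []) (i : ℕ) :
    (l.map f).seq i = f (l.seq i) := by
  induction i generalizing l with
  | zero => exact head_map f h
  | succ i ih =>
    rw [Nat.add_comm, ← seq_iterate_tail, ← seq_iterate_tail]
    simp only [Function.iterate_one, tail_map]
    exact ih (tail_snd_ne_nil h)

end Lasso

/-! ### Short walks -/

section Walks

variable {α : Type} {R : α → α → Prop}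

theorem isChain_cons_append {a b : α} {l m : List α} (hl : List.IsChain R (a :: l))
    (hb : (a :: l).getLast (by simp) = b) (hm : List.IsChain R (b :: m)) :
    List.IsChain R (a :: (l ++ m)) ∧
      (a :: (l ++ m)).getLast (by simp) = (b :: m).getLast (by simp) := by
  induction l generalizing a with
  | nil =>
    obtain rfl : a = b := by simpa using hb
    exact ⟨hm, rfl⟩
  | cons c l ih =>
    obtain ⟨h1, h2⟩ := List.isChain_cons_cons.1 hl
    obtain ⟨h3, h4⟩ := ih h2 (by simpa using hb)
    refine ⟨List.isChain_cons_cons.2 ⟨h1, h3⟩, ?_⟩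
    rw [← h4]
    simp

theorem exists_nodup_walk {a b : α} (h : Relation.ReflTransGen R a b) :
    ∃ l, List.IsChain R (a :: l) ∧ (a :: l).getLast (by simp) = b ∧ (a :: l).Nodup := by
  induction h using Relation.ReflTransGen.head_induction_on with
  | refl => exact ⟨[], by simp, by simp, by simp⟩
  | @head x y hxy _ ih =>
    obtain ⟨l, h1, h2, h3⟩ := ih
    by_cases hx : x ∈ y :: l
    · obtain ⟨p, q, hpq⟩ := List.append_of_mem hx
      refine ⟨q, ?_, ?_, ?_⟩
      · rw [hpq] at h1
        exact (List.isChain_append.1 h1).2.1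
      · rw [← h2]
        simp only [hpq]
        rw [List.getLast_append_of_ne_nil]
      · rw [hpq] at h3
        exact h3.of_append_right
    · exact ⟨y :: l, List.isChain_cons_cons.2 ⟨hxy, h1⟩, by simpa using h2,
        List.nodup_cons.2 ⟨hx, h3⟩⟩

theorem exists_short_walk [Fintype α] {a b : α} (h : Relation.TransGen R a b) :
    ∃ l, List.IsChain R (a :: l) ∧ (a :: l).getLast (by simp) = b ∧ b ∈ l ∧
      l.length ≤ Fintype.card α := by
  obtain ⟨c, hac, hcb⟩ := Relation.TransGen.head'_iff.1 h
  obtain ⟨l, h1, h2, h3⟩ := exists_nodup_walk hcb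
  refine ⟨c :: l, List.isChain_cons_cons.2 ⟨hac, h1⟩, by simpa using h2, ?_, h3.length_le_card⟩
  rw [← h2]
  exact List.getLast_mem _

theorem exists_tour [Fintype α] {I : Set α} (hI : ∀ a ∈ I, ∀ b ∈ I, Relation.TransGen R a b)
    (ys : List α) (hys : ∀ y ∈ ys, y ∈ I) {a : α} (ha : a ∈ I) :
    ∃ v, List.IsChain R (a :: v) ∧
      (a :: v).getLast (by simp) = (a :: ys).getLast (by simp) ∧
      (∀ y ∈ ys, y ∈ v) ∧ v.length ≤ Fintype.card α * ys.length := by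
  induction ys generalizing a with
  | nil => exact ⟨[], by simp, rfl, by simp, by simp⟩
  | cons y ys ih =>
    have hy := hys y (by simp)
    obtain ⟨l, h1, h2, h3, h4⟩ := exists_short_walk (hI a ha y hy)
    obtain ⟨v, h5, h6, h7, h8⟩ := ih (fun z hz => hys z (by simp [hz])) hy
    obtain ⟨h9, h10⟩ := isChain_cons_append h1 h2 h5
    refine ⟨l ++ v, h9, ?_, ?_, ?_⟩
    · rw [h10, h6]
      simp
    · intro z hz
      rcases List.mem_cons.1 hz with rfl | hz
      · exact List.mem_append_left _ h3
      · exact List.mem_append_right _ (h7 z hz)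
    · rw [List.length_append, List.length_cons, Nat.mul_add, Nat.mul_one]
      omega

/-- Every word over a finite alphabet has a short lasso with transitions from the word, whose loop
contains the letters that occur infinitely often. -/
theorem exists_lasso [Fintype α] [Inhabited α] (r : ℕ → α) :
    ∃ l : Lasso α, l.head = r 0 ∧ l.2 ≠ [] ∧ l.1.length ≤ Fintype.card α + 1 ∧
      l.2.length ≤ Fintype.card α * (Fintype.card α + 1) ∧
      (∀ i, ∃ j, r j = l.seq i ∧ r (j + 1) = l.seq (i + 1)) ∧
      ∃ t, ∀ s, t ≤ s → ∀ i, ∃ j, i ≤ j ∧ l.seq j = r s := by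
  classical
  set R : α → α → Prop := fun a b => ∃ j, r j = a ∧ r (j + 1) = b with hR
  set I : Finset α := Finset.univ.filter fun a => ∀ i, ∃ j, i ≤ j ∧ r j = a with hI
  have hmem : ∀ a, a ∈ I ↔ ∀ i, ∃ j, i ≤ j ∧ r j = a := by simp [hI]
  have hreach : ∀ i j, i < j → Relation.TransGen R (r i) (r j) := by
    intro i j hij
    induction j, hij using Nat.le_induction with
    | base => exact .single ⟨i, rfl, rfl⟩
    | succ j _ ih => exact ih.tail ⟨j, rfl, rfl⟩
  obtain ⟨t, ht⟩ : ∃ t, ∀ s, t ≤ s → r s ∈ I := by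
    have h : ∀ a, ∃ t, a ∉ I → ∀ s, t ≤ s → r s ≠ a := by
      intro a
      by_cases ha : a ∈ I
      · exact ⟨0, fun h => absurd ha h⟩
      · rw [hmem] at ha
        push Not at ha
        obtain ⟨t, ht⟩ := ha
        exact ⟨t, fun _ => ht⟩
    choose t ht using h
    refine ⟨Finset.univ.sup t, fun s hs => ?_⟩
    by_contra hc
    exact ht _ hc s ((Finset.le_sup (Finset.mem_univ _)).trans hs) rfl
  have hIr : ∀ a ∈ I, ∀ b ∈ I, Relation.TransGen R a b := by
    intro a ha b hb
    obtain ⟨i, -, rfl⟩ := (hmem a).1 ha 0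
    obtain ⟨j, hj, rfl⟩ := (hmem b).1 hb (i + 1)
    exact hreach i j hj
  set a := r (t + 1) with ha
  have haI : a ∈ I := ht _ (by omega)
  obtain ⟨u, hu1, hu2, -, hu4⟩ := exists_short_walk (hreach 0 (t + 1) (by omega))
  obtain ⟨v, hv1, hv2, hv3, hv4⟩ := exists_tour (I := (I : Set α)) (R := R)
    (fun a ha b hb => hIr a ha b hb) (I.toList ++ [a])
    (fun y hy => by
      rcases List.mem_append.1 hy with hy | hy
      · exact Finset.mem_toList.1 hy
      · rw [List.mem_singleton.1 hy]; exact haI) haI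
  have hvne : v ≠ [] := by
    rintro rfl
    simpa using hv3 a (by simp)
  obtain ⟨b, v', rfl⟩ := List.exists_cons_of_ne_nil hvne
  have hvl : (a :: b :: v').getLast (by simp) = a := by rw [hv2]; simp
  have hclosed : Lasso.IsClosed R (r 0 :: u, b :: v') := by
    refine ⟨hvne, ?_⟩
    obtain ⟨h1, h2⟩ := isChain_cons_append hu1 hu2 hv1
    have h3 := (isChain_cons_append (m := [b]) h1 (h2.trans hvl)
      (List.isChain_cons_cons.2 ⟨(List.isChain_cons_cons.1 hv1).1, by simp⟩)).1
    simpa using h3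
  refine ⟨(r 0 :: u, b :: v'), rfl, hvne, by simpa using hu4, hv4.trans ?_, hclosed.seq_rel, t,
    fun s hs i => Lasso.exists_le_seq_eq_of_mem (hv3 _ ?_) i⟩
  · refine Nat.mul_le_mul_left _ ?_
    rw [List.length_append, Finset.length_toList]
    exact Nat.add_le_add_right (Finset.card_le_univ _) 1
  · simp [ht s hs]

end Walks

/-! ### Truth on lassos -/

section Closure

variable {A AP : Type}

/-- The path formulas from which a path formula is built without path quantifiers. -/
def PathFormula.closure : PathFormula AP → List (PathFormula AP)
  | .ofState φ => [.ofState φ]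
  | .neg ψ => .neg ψ :: ψ.closure
  | .and ψ χ => .and ψ χ :: (ψ.closure ++ χ.closure)
  | .until ψ χ => .until ψ χ :: (ψ.closure ++ χ.closure)

theorem PathFormula.self_mem_closure (ψ : PathFormula AP) : ψ ∈ ψ.closure := by
  cases ψ <;> simp [PathFormula.closure]

theorem PathFormula.sat_until_iff {κ : PathConvention} {M : LTS A AP} {ψ χ : PathFormula AP}
    {π : ℕ → M.State} {i : ℕ} :
    (PathFormula.until ψ χ).Sat κ M (fun n => π (i + n)) ↔
      χ.Sat κ M (fun n => π (i + n)) ∨ (ψ.Sat κ M (fun n => π (i + n)) ∧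
        (PathFormula.until ψ χ).Sat κ M (fun n => π (i + 1 + n))) := by
  simp only [PathFormula.Sat, ← Nat.add_assoc]
  constructor
  · rintro ⟨j, hj, hb⟩
    cases j with
    | zero => exact Or.inl hj
    | succ j =>
      refine Or.inr ⟨hb 0 (by omega), j, ?_, fun m hm => ?_⟩
      · rwa [show i + 1 + j = i + (j + 1) by omega]
      · rw [show i + 1 + m = i + (m + 1) by omega]
        exact hb _ (by omega)
  · rintro (h | ⟨h, j, hj, hb⟩)
    · exact ⟨0, h, fun m hm => absurd hm (by omega)⟩
    · refine ⟨j + 1, ?_, fun m hm => ?_⟩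
      · rwa [show i + (j + 1) = i + 1 + j by omega]
      · cases m with
        | zero => exact h
        | succ m =>
          rw [show i + (m + 1) = i + 1 + m by omega]
          exact hb _ (by omega)

/-- A word whose transitions and whose recurring letters are taken from a path satisfies the same
formulas, if the letters record the truth of these formulas. -/
theorem PathFormula.sat_iff_record {κ : PathConvention} {M : LTS A AP} {π ρ : ℕ → M.State}
    {S : Set (PathFormula AP)} {b : ℕ → PathFormula AP → Prop}
    (h₁ : ∀ i, ∃ j, π j = ρ i ∧ (∀ χ ∈ S, b i χ ↔ χ.Sat κ M fun n => π (j + n)) ∧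
      ∀ χ ∈ S, b (i + 1) χ ↔ χ.Sat κ M fun n => π (j + 1 + n))
    (h₂ : ∃ t, ∀ s, t ≤ s → ∀ i, ∃ j, i ≤ j ∧ ∀ χ ∈ S, b j χ ↔ χ.Sat κ M fun n => π (s + n)) :
    ∀ ψ : PathFormula AP, (∀ χ ∈ ψ.closure, χ ∈ S) →
      ∀ i, ψ.Sat κ M (fun n => ρ (i + n)) ↔ b i ψ
  | .ofState φ, hS, i => by
      obtain ⟨j, hj, hb, -⟩ := h₁ i
      rw [hb _ (hS _ (PathFormula.self_mem_closure _))]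
      simp [PathFormula.Sat, hj]
  | .neg ψ, hS, i => by
      have h := PathFormula.sat_iff_record h₁ h₂ ψ
        (fun χ hχ => hS χ (by simp [PathFormula.closure, hχ])) i
      obtain ⟨j, hj, hb, -⟩ := h₁ i
      rw [hb _ (hS _ (PathFormula.self_mem_closure _))]
      rw [hb _ (hS _ (by simp [PathFormula.closure, PathFormula.self_mem_closure]))] at h
      simp only [PathFormula.Sat, h]
  | .and ψ χ, hS, i => by
      have h := PathFormula.sat_iff_record h₁ h₂ ψ
        (fun χ hχ => hS χ (by simp [PathFormula.closure, hχ])) i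
      have h' := PathFormula.sat_iff_record h₁ h₂ χ
        (fun χ hχ => hS χ (by simp [PathFormula.closure, hχ])) i
      obtain ⟨j, hj, hb, -⟩ := h₁ i
      rw [hb _ (hS _ (PathFormula.self_mem_closure _))]
      rw [hb _ (hS _ (by simp [PathFormula.closure, PathFormula.self_mem_closure]))] at h h'
      simp only [PathFormula.Sat, h, h']
  | .until ψ χ, hS, i => by
      have hψ := PathFormula.sat_iff_record h₁ h₂ ψ
        (fun χ hχ => hS χ (by simp [PathFormula.closure, hχ]))
      have hχ := PathFormula.sat_iff_record h₁ h₂ χ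
        (fun χ hχ => hS χ (by simp [PathFormula.closure, hχ]))
      have mU := hS _ (PathFormula.self_mem_closure _)
      have mψ := hS ψ (by simp [PathFormula.closure, PathFormula.self_mem_closure])
      have mχ := hS χ (by simp [PathFormula.closure, PathFormula.self_mem_closure])
      have hexp : ∀ i, b i (.until ψ χ) ↔ b i χ ∨ (b i ψ ∧ b (i + 1) (.until ψ χ)) := by
        intro i
        obtain ⟨j, -, hb, hb'⟩ := h₁ i
        rw [hb _ mU, hb _ mψ, hb _ mχ, hb' _ mU]
        exact PathFormula.sat_until_iff
      constructor
      · rintro ⟨m, hm, hbef⟩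
        simp only [← Nat.add_assoc] at hm hbef
        induction m generalizing i with
        | zero => exact (hexp i).2 (Or.inl ((hχ i).1 hm))
        | succ m ih =>
          refine (hexp i).2 (Or.inr ⟨(hψ i).1 (hbef 0 (by omega)), ih (i + 1) ?_ ?_⟩)
          · rwa [show i + 1 + m = i + (m + 1) by omega]
          · intro x hx
            rw [show i + 1 + x = i + (x + 1) by omega]
            exact hbef _ (by omega)
      · intro hU
        by_contra hc
        have hall : ∀ m, b (i + m) (.until ψ χ) ∧ (∀ x < m, b (i + x) ψ) ∧ ¬ b (i + m) χ := by
          intro m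
          induction m with
          | zero =>
            refine ⟨hU, fun x hx => absurd hx (by omega), fun h => hc ⟨0, ?_, ?_⟩⟩
            · simp only [← Nat.add_assoc]; exact (hχ _).2 h
            · intro x hx; omega
          | succ m ih =>
            obtain ⟨i1, i2, i3⟩ := ih
            obtain ⟨e1, e2⟩ := ((hexp _).1 i1).resolve_left i3
            have e3 : ∀ x < m + 1, b (i + x) ψ := fun x hx => by
              rcases Nat.lt_succ_iff_lt_or_eq.1 hx with h | rfl
              · exact i2 x h
              · exact e1
            refine ⟨e2, e3, fun h => hc ⟨m + 1, ?_, fun x hx => ?_⟩⟩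
            · simp only [← Nat.add_assoc]; exact (hχ _).2 h
            · simp only [← Nat.add_assoc]; exact (hψ _).2 (e3 x hx)
        obtain ⟨t, ht⟩ := h₂
        have hs : ∀ s, t ≤ s → (PathFormula.until ψ χ).Sat κ M (fun n => π (s + n)) ∧
            ¬ χ.Sat κ M (fun n => π (s + n)) := by
          intro s hs
          obtain ⟨j, hj, hb⟩ := ht s hs i
          have := hall (j - i)
          rw [Nat.add_sub_cancel' hj] at this
          exact ⟨(hb _ mU).1 this.1, fun h => this.2.2 ((hb _ mχ).2 h)⟩
        obtain ⟨m, hm, -⟩ := (hs t le_rfl).1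
        simp only [← Nat.add_assoc] at hm
        exact (hs (t + m) (by omega)).2 hm

theorem natCard_mem_list_le {β : Type} (l : List β) : Nat.card {x // x ∈ l} ≤ l.length := by
  have h := Nat.card_le_card_of_surjective
    (fun i : Fin l.length => (⟨l.get i, l.get_mem i⟩ : {x // x ∈ l})) (fun ⟨x, hx⟩ => by
      obtain ⟨i, hi⟩ := List.get_of_mem hx
      exact ⟨i, Subtype.ext hi⟩)
  simpa using h

/-- A satisfiable path formula is satisfied on a short lasso. -/
theorem PathFormula.exists_lasso {κ : PathConvention} {M : LTS A AP} [Inhabited M.State]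
    {X : List M.State} {ψ : PathFormula AP} {π : ℕ → M.State} (hX : ∀ i, π i ∈ X)
    (hπ : ψ.Sat κ M π) {K : ℕ} (hK : X.length * 2 ^ ψ.closure.length ≤ K) :
    ∃ l : Lasso M.State, l.head = π 0 ∧ l.1.length ≤ K + 1 ∧ l.2.length ≤ K * (K + 1) ∧
      (∀ x ∈ l.1 ++ l.2, x ∈ X) ∧ (∀ i, ∃ j, π j = l.seq i ∧ π (j + 1) = l.seq (i + 1)) ∧
      ψ.Sat κ M l.seq := by
  classical
  have : Finite {x // x ∈ X} := X.finite_toSet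
  have : Finite {χ // χ ∈ ψ.closure} := ψ.closure.finite_toSet
  let Rc := {x // x ∈ X} × ({χ // χ ∈ ψ.closure} → Prop)
  let r : ℕ → Rc := fun i => (⟨π i, hX i⟩, fun χ => χ.1.Sat κ M fun n => π (i + n))
  let _ : Inhabited Rc := ⟨r 0⟩
  let _ : Fintype Rc := Fintype.ofFinite Rc
  have hcard : Fintype.card Rc ≤ K := by
    refine le_trans ?_ hK
    rw [← Nat.card_eq_fintype_card, Nat.card_prod]
    refine Nat.mul_le_mul (natCard_mem_list_le X) ?_
    rw [Nat.card_fun, Nat.card_eq_fintype_card (α := Prop), Fintype.card_prop]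
    exact Nat.pow_le_pow_right (by norm_num) (natCard_mem_list_le _)
  obtain ⟨l, h1, h2, h3, h4, h5, t, h6⟩ := _root_.exists_lasso r
  refine ⟨l.map fun x => x.1.1, ?_, ?_, ?_, ?_, ?_, ?_⟩
  · rw [Lasso.head_map _ h2, h1]
  · simpa [Lasso.map] using h3.trans (by omega)
  · simpa [Lasso.map] using h4.trans (Nat.mul_le_mul hcard (by omega))
  · intro x hx
    simp only [Lasso.map, ← List.map_append, List.mem_map] at hx
    obtain ⟨y, -, rfl⟩ := hx
    exact y.1.2
  · intro i
    obtain ⟨j, hj, hj'⟩ := h5 i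
    exact ⟨j, by rw [Lasso.seq_map _ h2, ← hj], by rw [Lasso.seq_map _ h2, ← hj']⟩
  · have key := PathFormula.sat_iff_record (κ := κ) (M := M) (π := π)
      (ρ := fun i => (l.seq i).1.1) (S := {χ | χ ∈ ψ.closure})
      (b := fun i χ => ∃ h : χ ∈ ψ.closure, (l.seq i).2 ⟨χ, h⟩)
      (fun i => by
        obtain ⟨j, hj, hj'⟩ := h5 i
        refine ⟨j, by rw [← hj], fun χ hχ => ?_, fun χ hχ => ?_⟩
        · rw [← hj]
          exact ⟨fun ⟨_, h⟩ => h, fun h => ⟨hχ, h⟩⟩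
        · rw [← hj']
          exact ⟨fun ⟨_, h⟩ => h, fun h => ⟨hχ, h⟩⟩)
      ⟨t, fun s hs i => by
        obtain ⟨j, hij, hj⟩ := h6 s hs i
        refine ⟨j, hij, fun χ hχ => ?_⟩
        rw [hj]
        exact ⟨fun ⟨_, h⟩ => h, fun h => ⟨hχ, h⟩⟩⟩
      ψ (fun χ hχ => hχ) 0
    simp only [Nat.zero_add] at key
    rw [show (l.map fun x => x.1.1).seq = fun n => (l.seq n).1.1 from
      funext (Lasso.seq_map _ h2), key, Lasso.seq_zero, h1]
    refine ⟨ψ.self_mem_closure, ?_⟩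
    show ψ.Sat κ M fun n => π (0 + n)
    simpa using hπ

end Closure

/-! ## A model checker for finite transition systems -/

section Checker

variable {α : Type}

/-- The transition system with a list of edges and a list of pairs of a state and an atom. -/
def listLTS (n : ℕ) (E : List (α × α)) (A : List (α × ℕ × ℕ)) : LTS Unit (ℕ × Fin n) where
  State := α
  init := ∅
  tr s _ t := (s, t) ∈ E
  label s := {a | (s, a.1, (a.2 : ℕ)) ∈ A}

theorem listLTS_isPath_iff {n : ℕ} {E : List (α × α)} {A : List (α × ℕ × ℕ)} {π : ℕ → α} :
    (listLTS n E A).IsPath .infinite π ↔ ∀ i, (π i, π (i + 1)) ∈ E :=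
  ⟨fun h i => (h i).elim fun _ h => h, fun h i => ⟨(), h i⟩⟩

/-- All lists of length at most `m` with entries in `X`. -/
def listsUpTo (X : List α) : ℕ → List (List α)
  | 0 => [[]]
  | m + 1 => [] :: X.flatMap fun a => (listsUpTo X m).map fun l => a :: l

theorem mem_listsUpTo {X : List α} {m : ℕ} {l : List α} :
    l ∈ listsUpTo X m ↔ l.length ≤ m ∧ ∀ a ∈ l, a ∈ X := by
  induction m generalizing l with
  | zero => cases l <;> simp [listsUpTo]
  | succ m ih =>
    cases l with
    | nil => simp [listsUpTo]
    | cons a l => simp [listsUpTo, ih, and_left_comm]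

/-- All lassos over `X` with both parts of length at most `m`. -/
def lassosUpTo (X : List α) (m : ℕ) : List (Lasso α) :=
  (listsUpTo X m).flatMap fun u => (listsUpTo X m).map fun v => (u, v)

theorem mem_lassosUpTo {X : List α} {m : ℕ} {l : Lasso α} :
    l ∈ lassosUpTo X m ↔ (l.1.length ≤ m ∧ l.2.length ≤ m) ∧ ∀ a ∈ l.1 ++ l.2, a ∈ X := by
  obtain ⟨u, v⟩ := l
  simp only [lassosUpTo, List.mem_flatMap, List.mem_map, Prod.mk.injEq, mem_listsUpTo,
    List.mem_append]
  constructor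
  · rintro ⟨_, ⟨h1, h2⟩, _, ⟨h3, h4⟩, rfl, rfl⟩
    exact ⟨⟨h1, h3⟩, fun a ha => ha.elim (h2 a) (h4 a)⟩
  · rintro ⟨⟨h1, h3⟩, h⟩
    exact ⟨u, ⟨h1, fun a ha => h a (Or.inl ha)⟩, v, ⟨h3, fun a ha => h a (Or.inr ha)⟩, rfl, rfl⟩

theorem tail_mem_lassosUpTo {X : List α} {m : ℕ} {l : Lasso α} (h : l ∈ lassosUpTo X m) :
    l.tail ∈ lassosUpTo X m := by
  rw [mem_lassosUpTo] at h ⊢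
  obtain ⟨_ | ⟨a, u⟩, _ | ⟨b, v⟩⟩ := l
  · exact h
  · simpa [Lasso.tail, or_comm] using h
  · obtain ⟨⟨h1, h2⟩, h3⟩ := h
    exact ⟨⟨by simp only [List.length_cons] at h1; simp only [Lasso.tail]; omega, h2⟩,
      fun x hx => h3 x (by simp only [Lasso.tail] at hx; simp_all)⟩
  · obtain ⟨⟨h1, h2⟩, h3⟩ := h
    exact ⟨⟨by simp only [List.length_cons] at h1; simp only [Lasso.tail]; omega, h2⟩,
      fun x hx => h3 x (by simp only [Lasso.tail] at hx; simp_all)⟩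

theorem iterate_mem {β : Type} {U : List β} {f : β → β} (hU : ∀ l ∈ U, f l ∈ U) {l : β}
    (hl : l ∈ U) (j : ℕ) : f^[j] l ∈ U := by
  induction j with
  | zero => exact hl
  | succ j ih => rw [Function.iterate_succ_apply']; exact hU _ ih

/-- The orbit of an element of a finite invariant set is run through quickly. -/
theorem exists_iterate_eq_lt_length {β : Type} {U : List β} {f : β → β}
    (hU : ∀ l ∈ U, f l ∈ U) {l : β} (hl : l ∈ U) (j : ℕ) :
    ∃ i, i < U.length ∧ i ≤ j ∧ f^[i] l = f^[j] l := by
  classical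
  induction j using Nat.strong_induction_on with
  | _ j ih =>
    by_cases hj : j < U.length
    · exact ⟨j, hj, le_rfl, rfl⟩
    · obtain ⟨a, ha, b, hb, hne, hab⟩ := Finset.exists_ne_map_eq_of_card_lt_of_maps_to
        (s := Finset.range (U.length + 1)) (t := U.toFinset) (f := fun i => f^[i] l)
        (by rw [Finset.card_range]; exact Nat.lt_succ_of_le U.toFinset_card_le)
        (fun i _ => by simpa using iterate_mem hU hl i)
      wlog hlt : a < b generalizing a b
      · exact this b hb a ha hne.symm hab.symm (by omega)
      rw [Finset.mem_range] at hb
      obtain ⟨i, h1, h2, h3⟩ := ih (j - b + a) (by omega)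
      refine ⟨i, h1, by omega, ?_⟩
      rw [h3, Function.iterate_add_apply]
      rw [hab, ← Function.iterate_add_apply, Nat.sub_add_cancel (by omega)]

theorem forall_seq_rel_iff [Inhabited α] {U : List (Lasso α)} {E : List (α × α)}
    (hU : ∀ l ∈ U, l.tail ∈ U) {l : Lasso α} (hl : l ∈ U) :
    (∀ i ∈ List.range U.length, (l.seq i, l.seq (i + 1)) ∈ E) ↔
      ∀ i, (l.seq i, l.seq (i + 1)) ∈ E := by
  refine ⟨fun h j => ?_, fun h i _ => h i⟩
  obtain ⟨i, h1, -, h2⟩ := exists_iterate_eq_lt_length hU hl j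
  have h3 : l.seq i = l.seq j := by rw [Lasso.seq, h2, Lasso.seq]
  have h4 : l.seq (i + 1) = l.seq (j + 1) := by
    rw [Lasso.seq, Lasso.seq, Function.iterate_succ_apply', h2, Function.iterate_succ_apply']
  rw [← h3, ← h4]
  exact h i (List.mem_range.2 h1)

variable [Inhabited α] {n N : ℕ} {U : List (Lasso α)} {E : List (α × α)} {A : List (α × ℕ × ℕ)}

/-- Every satisfiable path formula with number at most `N` is satisfied on a path in `U`. -/
def LassoComplete (n N : ℕ) (U : List (Lasso α)) (E : List (α × α)) (A : List (α × ℕ × ℕ)) :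
    Prop :=
  (∀ l ∈ U, l.tail ∈ U) ∧ ∀ ψ : PathFormula (ℕ × Fin n), ψ.code ≤ N → ∀ π : ℕ → α,
    (∀ i, (π i, π (i + 1)) ∈ E) → ψ.Sat .infinite (listLTS n E A) π →
    ∃ l ∈ U, l.head = π 0 ∧ (∀ i, (l.seq i, l.seq (i + 1)) ∈ E) ∧
      ψ.Sat .infinite (listLTS n E A) l.seq

theorem PathFormula.length_closure_le (ψ : PathFormula (ℕ × Fin n)) :
    ψ.closure.length ≤ ψ.code + 1 := by
  match ψ with
  | .ofState φ => simp [PathFormula.closure]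
  | .neg ψ =>
    have := ψ.length_closure_le
    have h1 := Nat.add_le_pair 2 ψ.code
    simp only [PathFormula.closure, PathFormula.code, List.length_cons]
    omega
  | .and ψ χ =>
    have := ψ.length_closure_le
    have := χ.length_closure_le
    have h1 := Nat.add_le_pair 3 (Nat.pair ψ.code χ.code)
    have h2 := Nat.add_le_pair ψ.code χ.code
    simp only [PathFormula.closure, PathFormula.code, List.length_cons, List.length_append]
    omega
  | .until ψ χ =>
    have := ψ.length_closure_le
    have := χ.length_closure_le
    have h1 := Nat.add_le_pair 4 (Nat.pair ψ.code χ.code)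
    have h2 := Nat.add_le_pair ψ.code χ.code
    simp only [PathFormula.closure, PathFormula.code, List.length_cons, List.length_append]
    omega

/-- A bound for the lengths of lassos that have to be inspected. -/
def lassoBound (m N : ℕ) : ℕ := (m * 2 ^ (N + 1) + 1) * (m * 2 ^ (N + 1) + 1)

theorem lassoComplete_lassosUpTo {X : List α} (hE : ∀ e ∈ E, e.1 ∈ X) :
    LassoComplete n N (lassosUpTo X (lassoBound X.length N)) E A := by
  refine ⟨fun l => tail_mem_lassosUpTo, fun ψ hψ π hπ hsat => ?_⟩
  let _ : Inhabited (listLTS n E A).State := ‹Inhabited α›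
  set K := X.length * 2 ^ (N + 1) with hK
  obtain ⟨l, h1, h2, h3, h4, h5, h6⟩ := PathFormula.exists_lasso (M := listLTS n E A) (X := X)
    (κ := .infinite) (ψ := ψ) (π := π) (fun i => hE _ (hπ i)) hsat (K := K)
    (Nat.mul_le_mul_left _ (Nat.pow_le_pow_right (by norm_num)
      (ψ.length_closure_le.trans (by omega))))
  refine ⟨l, mem_lassosUpTo.2 ⟨⟨h2.trans ?_, h3.trans ?_⟩, h4⟩, h1, fun i => ?_, h6⟩
  · exact Nat.le_mul_of_pos_left _ (Nat.succ_pos K)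
  · exact Nat.mul_le_mul_right _ (Nat.le_succ K)
  · obtain ⟨j, h7, h8⟩ := h5 i
    have := hπ j
    rw [h7, h8] at this
    exact this

variable [DecidableEq α]

/-- The lassos, among those in `U`, that satisfy a state formula in the first state, from the
number of the formula and the tables for smaller numbers. -/
def stateEntry (U : List (Lasso α)) (E : List (α × α)) (A : List (α × ℕ × ℕ))
    (tbl : List (List (Lasso α) × List (Lasso α))) (c : ℕ × ℕ) : List (Lasso α) :=
  if c.1 = 1 then U
  else if c.1 = 2 then U.filter fun l => (l.head, c.2.unpair) ∈ A
  else if c.1 = 3 then U.filter fun l => l ∉ (tbl.getD c.2 ([], [])).1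
  else if c.1 = 4 then U.filter fun l =>
    l ∈ (tbl.getD c.2.unpair.1 ([], [])).1 ∧ l ∈ (tbl.getD c.2.unpair.2 ([], [])).1
  else U.filter fun l => ∃ l' ∈ (tbl.getD c.2 ([], [])).2, l'.head = l.head ∧
    ∀ i ∈ List.range U.length, (l'.seq i, l'.seq (i + 1)) ∈ E

/-- The lassos, among those in `U`, that satisfy a path formula. -/
def pathEntry (U : List (Lasso α)) (tbl : List (List (Lasso α) × List (Lasso α)))
    (c : ℕ × ℕ) : List (Lasso α) :=
  if c.1 = 1 then U.filter fun l => l ∈ (tbl.getD c.2 ([], [])).1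
  else if c.1 = 2 then U.filter fun l => l ∉ (tbl.getD c.2 ([], [])).2
  else if c.1 = 3 then U.filter fun l =>
    l ∈ (tbl.getD c.2.unpair.1 ([], [])).2 ∧ l ∈ (tbl.getD c.2.unpair.2 ([], [])).2
  else U.filter fun l => ∃ j ∈ List.range U.length,
    Lasso.tail^[j] l ∈ (tbl.getD c.2.unpair.2 ([], [])).2 ∧
      ∀ i ∈ List.range j, Lasso.tail^[i] l ∈ (tbl.getD c.2.unpair.1 ([], [])).2

/-- The tables for all formulas with numbers less than `m`. -/
def truthTable (U : List (Lasso α)) (E : List (α × α)) (A : List (α × ℕ × ℕ)) :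
    ℕ → List (List (Lasso α) × List (Lasso α))
  | 0 => []
  | m + 1 => truthTable U E A m ++
      [(stateEntry U E A (truthTable U E A m) m.unpair, pathEntry U (truthTable U E A m) m.unpair)]

theorem length_truthTable (m : ℕ) : (truthTable U E A m).length = m := by
  induction m with
  | zero => rfl
  | succ m ih => simp [truthTable, ih]

theorem truthTable_getD {i m : ℕ} (h : i < m) :
    (truthTable U E A m).getD i ([], []) =
      (stateEntry U E A (truthTable U E A i) i.unpair,
        pathEntry U (truthTable U E A i) i.unpair) := by
  induction m with
  | zero => omega
  | succ m ih =>
    rcases Nat.lt_succ_iff_lt_or_eq.1 h with h | rfl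
    · rw [← ih h, truthTable, List.getD_append]
      rwa [length_truthTable]
    · rw [truthTable, List.getD_append_right _ _ _ _ (by rw [length_truthTable])]
      simp [length_truthTable]

/-- The lassos that satisfy the state formula number `i`. -/
def stateTable (U : List (Lasso α)) (E : List (α × α)) (A : List (α × ℕ × ℕ)) (i : ℕ) :
    List (Lasso α) := stateEntry U E A (truthTable U E A i) i.unpair

/-- The lassos that satisfy the path formula number `i`. -/
def pathTable (U : List (Lasso α)) (E : List (α × α)) (A : List (α × ℕ × ℕ)) (i : ℕ) :
    List (Lasso α) := pathEntry U (truthTable U E A i) i.unpair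

theorem pathTable_subset {i : ℕ} {l : Lasso α} (h : l ∈ pathTable U E A i) : l ∈ U := by
  unfold pathTable pathEntry at h
  split_ifs at h <;> exact (List.mem_filter.1 h).1

theorem lt_pair_right {a b : ℕ} (h : 0 < a) : b < Nat.pair a b := by
  have := Nat.add_le_pair a b
  omega

theorem lt_pair_pair {a b c : ℕ} (h : 0 < a) :
    b < Nat.pair a (Nat.pair b c) ∧ c < Nat.pair a (Nat.pair b c) := by
  have h1 := Nat.add_le_pair a (Nat.pair b c)
  have h2 := Nat.add_le_pair b c
  omega

theorem truthTable_getD_fst {i m : ℕ} (h : i < m) :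
    ((truthTable U E A m).getD i ([], [])).1 = stateTable U E A i := by
  rw [truthTable_getD h, stateTable]

theorem truthTable_getD_snd {i m : ℕ} (h : i < m) :
    ((truthTable U E A m).getD i ([], [])).2 = pathTable U E A i := by
  rw [truthTable_getD h, pathTable]

mutual

theorem mem_stateTable_iff (h : LassoComplete n N U E A) :
    ∀ φ : StateFormula (ℕ × Fin n), φ.code ≤ N → ∀ l ∈ U,
      (l ∈ stateTable U E A φ.code ↔ φ.Sat .infinite (listLTS n E A) l.head)
  | .tru, _, l, hl => by
      simp [stateTable, stateEntry, StateFormula.code, StateFormula.Sat, hl]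
  | .atom a, _, l, hl => by
      simp [stateTable, stateEntry, StateFormula.code, StateFormula.Sat, hl, listLTS]
  | .neg φ, hN, l, hl => by
      rw [StateFormula.code] at hN
      have h1 : φ.code < Nat.pair 3 φ.code := lt_pair_right (by norm_num)
      have := mem_stateTable_iff h φ (by omega) l hl
      rw [stateTable, stateEntry, StateFormula.code, Nat.unpair_pair, truthTable_getD_fst h1]
      simp [StateFormula.Sat, ← this, hl]
  | .and φ χ, hN, l, hl => by
      rw [StateFormula.code] at hN
      have h1 := @lt_pair_pair 4 φ.code χ.code (by norm_num)
      have e1 := mem_stateTable_iff h φ (by omega) l hl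
      have e2 := mem_stateTable_iff h χ (by omega) l hl
      rw [stateTable, stateEntry, StateFormula.code, Nat.unpair_pair, Nat.unpair_pair,
        truthTable_getD_fst h1.1, truthTable_getD_fst h1.2]
      simp [StateFormula.Sat, ← e1, ← e2, hl]
  | .ex ψ, hN, l, hl => by
      rw [StateFormula.code] at hN
      have h1 : ψ.code < Nat.pair 5 ψ.code := lt_pair_right (by norm_num)
      have e := mem_pathTable_iff h ψ (by omega)
      rw [stateTable, stateEntry, StateFormula.code, Nat.unpair_pair, truthTable_getD_snd h1]
      simp only [StateFormula.Sat]
      norm_num only [if_false, List.mem_filter, decide_eq_true_eq, hl, true_and]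
      constructor
      · rintro ⟨l', hl', h2, h3⟩
        have hl'U := pathTable_subset hl'
        exact ⟨l'.seq, listLTS_isPath_iff.2 ((forall_seq_rel_iff h.1 hl'U).1 h3), h2,
          (e l' hl'U).1 hl'⟩
      · rintro ⟨π, hπ, h0, hsat⟩
        obtain ⟨l', hl', h2, h3, h4⟩ := h.2 ψ (by omega) π (listLTS_isPath_iff.1 hπ) hsat
        exact ⟨l', (e l' hl').2 h4, h2.trans h0, fun i _ => h3 i⟩

theorem mem_pathTable_iff (h : LassoComplete n N U E A) :
    ∀ ψ : PathFormula (ℕ × Fin n), ψ.code ≤ N → ∀ l ∈ U,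
      (l ∈ pathTable U E A ψ.code ↔ ψ.Sat .infinite (listLTS n E A) l.seq)
  | .ofState φ, hN, l, hl => by
      rw [PathFormula.code] at hN
      have h1 : φ.code < Nat.pair 1 φ.code := lt_pair_right (by norm_num)
      have := mem_stateTable_iff h φ (by omega) l hl
      rw [pathTable, pathEntry, PathFormula.code, Nat.unpair_pair, truthTable_getD_fst h1]
      simp [PathFormula.Sat, Lasso.seq_zero, ← this, hl]
  | .neg ψ, hN, l, hl => by
      rw [PathFormula.code] at hN
      have h1 : ψ.code < Nat.pair 2 ψ.code := lt_pair_right (by norm_num)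
      have := mem_pathTable_iff h ψ (by omega) l hl
      rw [pathTable, pathEntry, PathFormula.code, Nat.unpair_pair, truthTable_getD_snd h1]
      simp [PathFormula.Sat, ← this, hl]
  | .and ψ χ, hN, l, hl => by
      rw [PathFormula.code] at hN
      have h1 := @lt_pair_pair 3 ψ.code χ.code (by norm_num)
      have e1 := mem_pathTable_iff h ψ (by omega) l hl
      have e2 := mem_pathTable_iff h χ (by omega) l hl
      rw [pathTable, pathEntry, PathFormula.code, Nat.unpair_pair, Nat.unpair_pair,
        truthTable_getD_snd h1.1, truthTable_getD_snd h1.2]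
      simp [PathFormula.Sat, ← e1, ← e2, hl]
  | .until ψ χ, hN, l, hl => by
      rw [PathFormula.code] at hN
      have h1 := @lt_pair_pair 4 ψ.code χ.code (by norm_num)
      have e1 := fun j => mem_pathTable_iff h ψ (by omega) _ (iterate_mem h.1 hl j)
      have e2 := fun j => mem_pathTable_iff h χ (by omega) _ (iterate_mem h.1 hl j)
      have e3 : ∀ j, (Lasso.tail^[j] l).seq = fun n => l.seq (j + n) :=
        fun j => funext (Lasso.seq_iterate_tail l j)
      rw [pathTable, pathEntry, PathFormula.code, Nat.unpair_pair, Nat.unpair_pair,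
        truthTable_getD_snd h1.1, truthTable_getD_snd h1.2]
      simp only [PathFormula.Sat, ← e3, ← e1, ← e2]
      norm_num only [if_false, List.mem_filter, decide_eq_true_eq, hl, true_and, List.mem_range]
      constructor
      · rintro ⟨j, -, h2, h3⟩
        exact ⟨j, h2, h3⟩
      · rintro ⟨j, h2, h3⟩
        obtain ⟨i, i1, i2, i3⟩ := exists_iterate_eq_lt_length h.1 hl j
        exact ⟨i, i1, by rwa [i3], fun m hm => h3 m (by omega)⟩

end

/-- The model checker, for the transition system with states `X`, edges `E` and atoms `A`, the
state `s` and the formula number `c`. -/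
def modelCheck (X : List α) (E : List (α × α)) (A : List (α × ℕ × ℕ)) (s : α) (c : ℕ) : Bool :=
  ([s], []) ∈ stateTable (lassosUpTo X (lassoBound X.length c)) E A c

theorem modelCheck_iff {X : List α} (hE : ∀ e ∈ E, e.1 ∈ X) {s : α} (hs : s ∈ X)
    (φ : StateFormula (ℕ × Fin n)) :
    modelCheck X E A s φ.code = true ↔ φ.Sat .infinite (listLTS n E A) s := by
  rw [modelCheck, decide_eq_true_eq, mem_stateTable_iff (lassoComplete_lassosUpTo hE) φ le_rfl]
  · rfl
  · rw [mem_lassosUpTo]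
    refine ⟨⟨Nat.mul_pos (Nat.succ_pos _) (Nat.succ_pos _), Nat.zero_le _⟩, by simpa using hs⟩

end Checker

/-! ## The model checker is primitive recursive -/

section Primrec

variable {α β γ : Type} [Primcodable α] [Primcodable β] [Primcodable γ]

theorem PrimrecPred.exists_mem_comp {f : β → List α} {p : β → α → Prop} (hf : Primrec f)
    (hp : PrimrecPred fun x : β × α => p x.1 x.2) : PrimrecPred fun b => ∃ a ∈ f b, p b a :=
  (PrimrecRel.exists_mem_list (R := fun a b => p b a)
    (hp.comp (Primrec.snd.pair Primrec.fst))).comp hf Primrec.id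

theorem PrimrecPred.forall_mem_comp {f : β → List α} {p : β → α → Prop} (hf : Primrec f)
    (hp : PrimrecPred fun x : β × α => p x.1 x.2) : PrimrecPred fun b => ∀ a ∈ f b, p b a :=
  (PrimrecRel.forall_mem_list (R := fun a b => p b a)
    (hp.comp (Primrec.snd.pair Primrec.fst))).comp hf Primrec.id

theorem PrimrecPred.mem_comp {f : β → List α} {g : β → α} (hf : Primrec f) (hg : Primrec g) :
    PrimrecPred fun b => g b ∈ f b :=
  (PrimrecPred.exists_mem_comp (p := fun b a => a = g b) hf
    (Primrec.eq.comp Primrec.snd (hg.comp Primrec.fst))).of_eq fun b => by simp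

theorem PrimrecPred.const (q : Prop) : PrimrecPred fun _ : β => q := by
  classical exact ⟨fun _ => inferInstance, Primrec.const _⟩

theorem PrimrecPred.forall_mem_finite {ι : Type} {S : Set ι} (hS : S.Finite) {p : ι → β → Prop}
    (hp : ∀ i, PrimrecPred (p i)) : PrimrecPred fun b => ∀ i ∈ S, p i b := by
  induction S, hS using Set.Finite.induction_on with
  | empty => exact (PrimrecPred.const True).of_eq fun b => by simp
  | @insert i _ _ _ ih => exact ((hp i).and ih).of_eq fun b => by simp

theorem PrimrecPred.forall_finite {ι : Type} [Finite ι] {p : ι → β → Prop}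
    (hp : ∀ i, PrimrecPred (p i)) : PrimrecPred fun b => ∀ i, p i b :=
  (PrimrecPred.forall_mem_finite Set.finite_univ hp).of_eq fun b => by simp

theorem PrimrecPred.exists_finite {ι : Type} [Finite ι] {p : ι → β → Prop}
    (hp : ∀ i, PrimrecPred (p i)) : PrimrecPred fun b => ∃ i, p i b :=
  (PrimrecPred.forall_finite fun i => (hp i).not).not.of_eq fun b => by simp

theorem Primrec.filter_comp {f : β → List α} {p : β → α → Prop} [∀ b, DecidablePred (p b)]
    (hf : Primrec f) (hp : PrimrecPred fun x : β × α => p x.1 x.2) :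
    Primrec fun b => (f b).filter fun a => p b a := by
  refine (Primrec.list_flatMap (g := fun b a => if p b a then [a] else []) hf
    (Primrec.ite hp (Primrec.list_cons.comp Primrec.snd (Primrec.const []))
      (Primrec.const []))).of_eq fun b => ?_
  induction f b with
  | nil => rfl
  | cons a l ih =>
    rw [List.flatMap_cons, ih, List.filter_cons]
    by_cases h : p b a <;> simp [h]

theorem Primrec.two_pow : Primrec fun n : ℕ => 2 ^ n := by
  refine (Primrec.nat_iterate (f := fun n : ℕ => n) (g := fun _ => 1) (h := fun _ x => 2 * x)
    Primrec.id (Primrec.const 1)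
    (Primrec.nat_mul.comp (Primrec.const 2) Primrec.snd)).of_eq fun n => ?_
  induction n with
  | zero => rfl
  | succ n ih => rw [Function.iterate_succ_apply', ih, pow_succ, mul_comm]

theorem primrec_lassoBound : Primrec₂ lassoBound := by
  have h : Primrec fun x : ℕ × ℕ => x.1 * 2 ^ (x.2 + 1) + 1 :=
    Primrec.succ.comp (Primrec.nat_mul.comp Primrec.fst
      (Primrec.two_pow.comp (Primrec.succ.comp Primrec.snd)))
  exact Primrec.nat_mul.comp h h

theorem primrec_listsUpTo : Primrec₂ (listsUpTo : List α → ℕ → List (List α)) := by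
  refine (Primrec.nat_rec (f := fun _ : List α => [[]])
    (g := fun X p => [] :: X.flatMap fun a => p.2.map fun l => a :: l) (Primrec.const _)
    (Primrec.list_cons.comp (Primrec.const []) (Primrec.list_flatMap Primrec.fst
      (Primrec.list_map (Primrec.snd.comp (Primrec.snd.comp Primrec.fst))
        (Primrec.list_cons.comp (Primrec.snd.comp Primrec.fst) Primrec.snd))))).of_eq
    fun X m => ?_
  induction m with
  | zero => rfl
  | succ m ih => simp only [listsUpTo, ← ih]

theorem primrec_lassosUpTo : Primrec₂ (lassosUpTo : List α → ℕ → List (Lasso α)) :=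
  Primrec.list_flatMap primrec_listsUpTo
    (Primrec.list_map (primrec_listsUpTo.comp (Primrec.fst.comp Primrec.fst)
      (Primrec.snd.comp Primrec.fst)) (Primrec.pair (Primrec.snd.comp Primrec.fst) Primrec.snd))

theorem Lasso.primrec_tail : Primrec (Lasso.tail : Lasso α → Lasso α) := by
  refine (Primrec.list_casesOn (f := fun l : Lasso α => l.1)
    (g := fun l => List.casesOn (motive := fun _ => Lasso α) l.2 ([], [])
      fun a v => ([], v ++ [a]))
    (h := fun l p => (p.2, l.2)) Primrec.fst ?_ ?_).of_eq ?_
  · exact Primrec.list_casesOn (f := fun l : Lasso α => l.2) (g := fun _ => ([], []))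
      (h := fun _ p => ([], p.2 ++ [p.1])) Primrec.snd (Primrec.const _)
      (Primrec.pair (Primrec.const _) (Primrec.list_append.comp (Primrec.snd.comp Primrec.snd)
        (Primrec.list_cons.comp (Primrec.fst.comp Primrec.snd) (Primrec.const []))))
  · exact Primrec.pair (Primrec.snd.comp Primrec.snd) (Primrec.snd.comp Primrec.fst)
  · rintro ⟨_ | ⟨a, u⟩, _ | ⟨b, v⟩⟩ <;> rfl

theorem Lasso.primrec_iterate_tail :
    Primrec₂ fun (i : ℕ) (l : Lasso α) => Lasso.tail^[i] l :=
  Primrec.nat_iterate Primrec.fst Primrec.snd (Lasso.primrec_tail.comp Primrec.snd)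

theorem Lasso.primrec_head [Inhabited α] : Primrec (Lasso.head : Lasso α → α) :=
  Primrec.list_headI.comp (Primrec.list_append.comp Primrec.fst Primrec.snd)

theorem Lasso.primrec_seq [Inhabited α] : Primrec₂ (Lasso.seq : Lasso α → ℕ → α) :=
  Lasso.primrec_head.comp (Lasso.primrec_iterate_tail.comp Primrec.snd Primrec.fst)

theorem primrec_tableEntry {f : β → List (List (Lasso α) × List (Lasso α))} {g : β → ℕ}
    (hf : Primrec f) (hg : Primrec g) : Primrec fun b => (f b).getD (g b) ([], []) :=
  (Primrec.list_getD _).comp hf hg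

variable [DecidableEq α]

/-- The arguments of the entries of the truth table. -/
abbrev EntryInput (α : Type) : Type :=
  (List (Lasso α) × List (α × α) × List (α × ℕ × ℕ)) ×
    List (List (Lasso α) × List (Lasso α)) × ℕ × ℕ

theorem primrec_pathEntry :
    Primrec fun q : EntryInput α => pathEntry q.1.1 q.2.1 q.2.2 := by
  have hU : Primrec fun q : EntryInput α => q.1.1 := Primrec.fst.comp Primrec.fst
  have ht : Primrec fun q : EntryInput α => q.2.1 := Primrec.fst.comp Primrec.snd
  have hc : Primrec fun q : EntryInput α => q.2.2.1 :=
    Primrec.fst.comp (Primrec.snd.comp Primrec.snd)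
  have hx : Primrec fun q : EntryInput α => q.2.2.2 :=
    Primrec.snd.comp (Primrec.snd.comp Primrec.snd)
  have hx' := Primrec.unpair.comp hx
  have h1 := primrec_tableEntry ht hx
  have h2 := primrec_tableEntry ht (Primrec.fst.comp hx')
  have h3 := primrec_tableEntry ht (Primrec.snd.comp hx')
  refine Primrec.ite (Primrec.eq.comp hc (Primrec.const 1)) (Primrec.filter_comp hU ?_) ?_
  · exact PrimrecPred.mem_comp ((Primrec.fst.comp h1).comp Primrec.fst) Primrec.snd
  refine Primrec.ite (Primrec.eq.comp hc (Primrec.const 2)) (Primrec.filter_comp hU ?_) ?_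
  · exact (PrimrecPred.mem_comp ((Primrec.snd.comp h1).comp Primrec.fst) Primrec.snd).not
  refine Primrec.ite (Primrec.eq.comp hc (Primrec.const 3)) (Primrec.filter_comp hU ?_) ?_
  · exact (PrimrecPred.mem_comp ((Primrec.snd.comp h2).comp Primrec.fst) Primrec.snd).and
      (PrimrecPred.mem_comp ((Primrec.snd.comp h3).comp Primrec.fst) Primrec.snd)
  refine Primrec.filter_comp hU (PrimrecPred.exists_mem_comp
    (Primrec.list_range.comp (Primrec.list_length.comp (hU.comp Primrec.fst)))
    (PrimrecPred.and (PrimrecPred.mem_comp ((Primrec.snd.comp h3).comp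
      (Primrec.fst.comp Primrec.fst)) ?_) (PrimrecPred.forall_mem_comp
        (Primrec.list_range.comp Primrec.snd) (PrimrecPred.mem_comp ((Primrec.snd.comp h2).comp
          (Primrec.fst.comp (Primrec.fst.comp Primrec.fst))) ?_))))
  · exact Lasso.primrec_iterate_tail.comp Primrec.snd (Primrec.snd.comp Primrec.fst)
  · exact Lasso.primrec_iterate_tail.comp Primrec.snd
      (Primrec.snd.comp (Primrec.fst.comp Primrec.fst))

variable [Inhabited α]

theorem primrec_stateEntry :
    Primrec fun q : EntryInput α => stateEntry q.1.1 q.1.2.1 q.1.2.2 q.2.1 q.2.2 := by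
  have hU : Primrec fun q : EntryInput α => q.1.1 := Primrec.fst.comp Primrec.fst
  have hE : Primrec fun q : EntryInput α => q.1.2.1 :=
    Primrec.fst.comp (Primrec.snd.comp Primrec.fst)
  have hA : Primrec fun q : EntryInput α => q.1.2.2 :=
    Primrec.snd.comp (Primrec.snd.comp Primrec.fst)
  have ht : Primrec fun q : EntryInput α => q.2.1 := Primrec.fst.comp Primrec.snd
  have hc : Primrec fun q : EntryInput α => q.2.2.1 :=
    Primrec.fst.comp (Primrec.snd.comp Primrec.snd)
  have hx : Primrec fun q : EntryInput α => q.2.2.2 :=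
    Primrec.snd.comp (Primrec.snd.comp Primrec.snd)
  have hx' := Primrec.unpair.comp hx
  have h1 := primrec_tableEntry ht hx
  have h2 := primrec_tableEntry ht (Primrec.fst.comp hx')
  have h3 := primrec_tableEntry ht (Primrec.snd.comp hx')
  refine Primrec.ite (Primrec.eq.comp hc (Primrec.const 1)) hU ?_
  refine Primrec.ite (Primrec.eq.comp hc (Primrec.const 2)) (Primrec.filter_comp hU ?_) ?_
  · exact PrimrecPred.mem_comp (hA.comp Primrec.fst)
      ((Lasso.primrec_head.comp Primrec.snd).pair (hx'.comp Primrec.fst))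
  refine Primrec.ite (Primrec.eq.comp hc (Primrec.const 3)) (Primrec.filter_comp hU ?_) ?_
  · exact (PrimrecPred.mem_comp ((Primrec.fst.comp h1).comp Primrec.fst) Primrec.snd).not
  refine Primrec.ite (Primrec.eq.comp hc (Primrec.const 4)) (Primrec.filter_comp hU ?_) ?_
  · exact (PrimrecPred.mem_comp ((Primrec.fst.comp h2).comp Primrec.fst) Primrec.snd).and
      (PrimrecPred.mem_comp ((Primrec.fst.comp h3).comp Primrec.fst) Primrec.snd)
  refine Primrec.filter_comp hU (PrimrecPred.exists_mem_comp
    ((Primrec.snd.comp h1).comp Primrec.fst) (PrimrecPred.and ?_ (PrimrecPred.forall_mem_comp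
      (Primrec.list_range.comp (Primrec.list_length.comp
        (hU.comp (Primrec.fst.comp Primrec.fst)))) (PrimrecPred.mem_comp
          (hE.comp (Primrec.fst.comp (Primrec.fst.comp Primrec.fst))) ?_))))
  · exact Primrec.eq.comp (Lasso.primrec_head.comp Primrec.snd)
      (Lasso.primrec_head.comp (Primrec.snd.comp Primrec.fst))
  · exact (Lasso.primrec_seq.comp (Primrec.snd.comp Primrec.fst) Primrec.snd).pair
      (Lasso.primrec_seq.comp (Primrec.snd.comp Primrec.fst) (Primrec.succ.comp Primrec.snd))

theorem primrec_truthTable :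
    Primrec₂ fun (a : List (Lasso α) × List (α × α) × List (α × ℕ × ℕ)) (m : ℕ) =>
      truthTable a.1 a.2.1 a.2.2 m := by
  have hin : Primrec₂ fun (a : List (Lasso α) × List (α × α) × List (α × ℕ × ℕ))
      (p : ℕ × List (List (Lasso α) × List (Lasso α))) => ((a, p.2, p.1.unpair) : EntryInput α) :=
    Primrec.fst.pair ((Primrec.snd.comp Primrec.snd).pair
      (Primrec.unpair.comp (Primrec.fst.comp Primrec.snd)))
  refine (Primrec.nat_rec (f := fun _ => [])
    (g := fun (a : List (Lasso α) × List (α × α) × List (α × ℕ × ℕ)) p =>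
      p.2 ++ [(stateEntry a.1 a.2.1 a.2.2 p.2 p.1.unpair, pathEntry a.1 p.2 p.1.unpair)])
    (Primrec.const _) (Primrec.list_append.comp (Primrec.snd.comp Primrec.snd)
      (Primrec.list_cons.comp ((primrec_stateEntry.comp hin).pair (primrec_pathEntry.comp hin))
        (Primrec.const [])))).of_eq fun a m => ?_
  induction m with
  | zero => rfl
  | succ m ih => simp only [truthTable, ← ih]

theorem primrec_modelCheck :
    Primrec fun q : (List α × List (α × α) × List (α × ℕ × ℕ)) × α × ℕ =>
      modelCheck q.1.1 q.1.2.1 q.1.2.2 q.2.1 q.2.2 := by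
  have hX : Primrec fun q : (List α × List (α × α) × List (α × ℕ × ℕ)) × α × ℕ => q.1.1 :=
    Primrec.fst.comp Primrec.fst
  have hc : Primrec fun q : (List α × List (α × α) × List (α × ℕ × ℕ)) × α × ℕ => q.2.2 :=
    Primrec.snd.comp Primrec.snd
  have ha : Primrec fun q : (List α × List (α × α) × List (α × ℕ × ℕ)) × α × ℕ =>
      (lassosUpTo q.1.1 (lassoBound q.1.1.length q.2.2), q.1.2) :=
    (primrec_lassosUpTo.comp hX
      (primrec_lassoBound.comp (Primrec.list_length.comp hX) hc)).pair
        (Primrec.snd.comp Primrec.fst)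
  have hin : Primrec fun q : (List α × List (α × α) × List (α × ℕ × ℕ)) × α × ℕ =>
      ((lassosUpTo q.1.1 (lassoBound q.1.1.length q.2.2), q.1.2),
        truthTable (lassosUpTo q.1.1 (lassoBound q.1.1.length q.2.2)) q.1.2.1 q.1.2.2 q.2.2,
        q.2.2.unpair) :=
    ha.pair ((primrec_truthTable.comp ha hc).pair (Primrec.unpair.comp hc))
  refine PrimrecPred.decide (PrimrecPred.mem_comp (primrec_stateEntry.comp hin) ?_)
  exact (Primrec.list_cons.comp (Primrec.fst.comp Primrec.snd) (Primrec.const [])).pair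
    (Primrec.const [])

theorem primrec_modelCheck_comp {X : β → List α} {E : β → List (α × α)}
    {A : β → List (α × ℕ × ℕ)} {s : β → α} {c : β → ℕ} (hX : Primrec X) (hE : Primrec E)
    (hA : Primrec A) (hs : Primrec s) (hc : Primrec c) :
    Primrec fun b => modelCheck (X b) (E b) (A b) (s b) (c b) := by
  have h := primrec_modelCheck.comp ((hX.pair (hE.pair hA)).pair (hs.pair hc))
  exact h

end Primrec

/-! ## Coded token-passing systems -/

section Embedding

variable {A A' AP : Type} {κ : PathConvention} {M : LTS A AP} {N : LTS A' AP}
  {f : M.State → N.State}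

/-- `f` identifies `M`, with the steps of the convention `κ`, with a part of `N` that is closed
under steps. -/
structure IsPathEmbedding (κ : PathConvention) (M : LTS A AP) (N : LTS A' AP)
    (f : M.State → N.State) : Prop where
  injective : Function.Injective f
  label_eq : ∀ s, M.label s = N.label (f s)
  step_iff : ∀ s t, N.Step (f s) (f t) ↔ M.PathStep κ s t
  closed : ∀ s y, N.Step (f s) y → ∃ t, f t = y

mutual

theorem StateFormula.sat_iff_of_isPathEmbedding (h : IsPathEmbedding κ M N f) :
    ∀ (φ : StateFormula AP) (s : M.State), φ.Sat κ M s ↔ φ.Sat .infinite N (f s)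
  | .tru, s => by simp [StateFormula.Sat]
  | .atom a, s => by simp [StateFormula.Sat, h.label_eq]
  | .neg φ, s => by
      simp only [StateFormula.Sat, StateFormula.sat_iff_of_isPathEmbedding h φ]
  | .and φ χ, s => by
      simp only [StateFormula.Sat, StateFormula.sat_iff_of_isPathEmbedding h φ,
        StateFormula.sat_iff_of_isPathEmbedding h χ]
  | .ex ψ, s => by
      have hψ := PathFormula.sat_iff_of_isPathEmbedding h ψ
      simp only [StateFormula.Sat]
      constructor
      · rintro ⟨π, hπ, rfl, hsat⟩
        rw [LTS.isPath_iff] at hπ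
        exact ⟨fun i => f (π i), fun i => (h.step_iff _ _).2 (hπ i), rfl, (hψ π).1 hsat⟩
      · rintro ⟨ρ, hρ, h0, hsat⟩
        have hex : ∀ i, ∃ t, f t = ρ i := by
          intro i
          induction i with
          | zero => exact ⟨s, h0.symm⟩
          | succ i ih =>
            obtain ⟨t, ht⟩ := ih
            exact h.closed t _ (by rw [ht]; exact hρ i)
        choose π hπ using hex
        obtain rfl : (fun i => f (π i)) = ρ := funext hπ
        exact ⟨π, LTS.isPath_iff.2 fun i => (h.step_iff _ _).1 (hρ i), h.injective h0,
          (hψ π).2 hsat⟩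

theorem PathFormula.sat_iff_of_isPathEmbedding (h : IsPathEmbedding κ M N f) :
    ∀ (ψ : PathFormula AP) (π : ℕ → M.State),
      ψ.Sat κ M π ↔ ψ.Sat .infinite N (fun i => f (π i))
  | .ofState φ, π => by
      simp only [PathFormula.Sat, StateFormula.sat_iff_of_isPathEmbedding h φ]
  | .neg ψ, π => by
      simp only [PathFormula.Sat, PathFormula.sat_iff_of_isPathEmbedding h ψ]
  | .and ψ χ, π => by
      simp only [PathFormula.Sat, PathFormula.sat_iff_of_isPathEmbedding h ψ,
        PathFormula.sat_iff_of_isPathEmbedding h χ]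
  | .until ψ χ, π => by
      simp only [PathFormula.Sat, PathFormula.sat_iff_of_isPathEmbedding h ψ,
        PathFormula.sat_iff_of_isPathEmbedding h χ]

end

end Embedding

namespace TemplateCode

theorem primrec_states : Primrec TemplateCode.states :=
  Primrec.fst.comp (Primrec.of_equiv (e := equivTuple))

theorem primrec_acts : Primrec TemplateCode.acts :=
  Primrec.fst.comp (Primrec.snd.comp (Primrec.of_equiv (e := equivTuple)))

theorem primrec_initTok : Primrec TemplateCode.initTok :=
  Primrec.fst.comp (Primrec.snd.comp (Primrec.snd.comp (Primrec.snd.comp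
    (Primrec.of_equiv (e := equivTuple)))))

theorem primrec_initNon : Primrec TemplateCode.initNon :=
  Primrec.fst.comp (Primrec.snd.comp (Primrec.snd.comp (Primrec.snd.comp (Primrec.snd.comp
    (Primrec.of_equiv (e := equivTuple))))))

theorem primrec_tr : Primrec TemplateCode.tr :=
  Primrec.fst.comp (Primrec.snd.comp (Primrec.snd.comp (Primrec.snd.comp (Primrec.snd.comp
    (Primrec.snd.comp (Primrec.of_equiv (e := equivTuple)))))))

theorem primrec_label : Primrec TemplateCode.label :=
  Primrec.snd.comp (Primrec.snd.comp (Primrec.snd.comp (Primrec.snd.comp (Primrec.snd.comp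
    (Primrec.snd.comp (Primrec.of_equiv (e := equivTuple)))))))

/-- The codes of the global states of a system with `m` processes. -/
def nodes (m : ℕ) (c : TemplateCode) : List (List ℕ) :=
  (listsUpTo (List.range c.states) m).filter fun σ => σ.length = m

/-- Coded internal transition of the process at `v`. -/
def IntMove {m : ℕ} (v : Fin m) (c : TemplateCode) (σ τ : List ℕ) : Prop :=
  (∃ b ∈ List.range c.acts, (σ.getD v 0, b + 2, τ.getD v 0) ∈ c.tr) ∧
    ∀ w : Fin m, w ≠ v → τ.getD w 0 = σ.getD w 0

/-- Coded transmission of the token from `v` to `w`. -/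
def TokMove (G : Topology) (v w : Fin G.size) (c : TemplateCode) (σ τ : List ℕ) : Prop :=
  G.Edge v w ∧ (σ.getD v 0, 0, τ.getD v 0) ∈ c.tr ∧ (σ.getD w 0, 1, τ.getD w 0) ∈ c.tr ∧
    ∀ u : Fin G.size, u ≠ v → u ≠ w → τ.getD u 0 = σ.getD u 0

/-- Coded global transition. -/
def Step (G : Topology) (c : TemplateCode) (σ τ : List ℕ) : Prop :=
  (∃ v : Fin G.size, IntMove v c σ τ) ∨ ∃ v w, TokMove G v w c σ τ

/-- Coded step of a path. -/
def PathStep (κ : PathConvention) (G : Topology) (c : TemplateCode) (σ τ : List ℕ) : Prop :=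
  Step G c σ τ ∨ (κ = .maximal ∧ (∀ υ ∈ c.nodes G.size, ¬ Step G c σ υ) ∧ τ = σ)

open Classical in
/-- All coded steps of paths. -/
noncomputable def edges (κ : PathConvention) (G : Topology) (c : TemplateCode) :
    List (List ℕ × List ℕ) :=
  ((c.nodes G.size).flatMap fun σ => (c.nodes G.size).map fun τ => (σ, τ)).filter
    fun e => PathStep κ G c e.1 e.2

/-- All true atoms of the processes at the vertices `g`. -/
def atoms {n m : ℕ} (g : Fin n → Fin m) (c : TemplateCode) : List (List ℕ × ℕ × ℕ) :=
  ((c.nodes m).flatMap fun σ => c.label.flatMap fun a => (List.range n).map fun x =>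
    (σ, a.2, x)).filter fun t =>
      (t.1.getD ((List.ofFn fun i => (g i : ℕ)).getD t.2.2 0) 0, t.2.1) ∈ c.label

/-- Code of the initial state. -/
def start (G : Topology) (c : TemplateCode) : List ℕ :=
  List.ofFn fun v : Fin G.size => if v = G.start then c.initTok else c.initNon

section Primrec

theorem primrec_nodes (m : ℕ) : Primrec (nodes m) :=
  Primrec.filter_comp (primrec_listsUpTo.comp (Primrec.list_range.comp primrec_states)
    (Primrec.const m)) (Primrec.eq.comp (Primrec.list_length.comp Primrec.snd) (Primrec.const m))

variable {β : Type} [Primcodable β] {c : β → TemplateCode} {σ τ : β → List ℕ}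

theorem primrec_entry (hσ : Primrec σ) (v : ℕ) : Primrec fun b => (σ b).getD v 0 :=
  (Primrec.list_getD 0).comp hσ (Primrec.const v)

theorem primrecPred_intMove {m : ℕ} (v : Fin m) (hc : Primrec c) (hσ : Primrec σ)
    (hτ : Primrec τ) : PrimrecPred fun b => IntMove v (c b) (σ b) (τ b) := by
  refine PrimrecPred.and (PrimrecPred.exists_mem_comp
    (Primrec.list_range.comp (primrec_acts.comp hc))
    (PrimrecPred.mem_comp ((primrec_tr.comp hc).comp Primrec.fst) ?_))
    (PrimrecPred.forall_finite fun w => ?_)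
  · exact ((primrec_entry hσ v).comp Primrec.fst).pair
      ((Primrec.nat_add.comp Primrec.snd (Primrec.const 2)).pair
        ((primrec_entry hτ v).comp Primrec.fst))
  · by_cases h : w = v
    · exact (PrimrecPred.const True).of_eq fun b => by simp [h]
    · exact (Primrec.eq.comp (primrec_entry hτ w) (primrec_entry hσ w)).of_eq
        fun b => by simp [h]

theorem primrecPred_tokMove {G : Topology} (v w : Fin G.size) (hc : Primrec c) (hσ : Primrec σ)
    (hτ : Primrec τ) : PrimrecPred fun b => TokMove G v w (c b) (σ b) (τ b) := by
  refine (PrimrecPred.const _).and (PrimrecPred.and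
    (PrimrecPred.mem_comp (primrec_tr.comp hc) ?_) (PrimrecPred.and
    (PrimrecPred.mem_comp (primrec_tr.comp hc) ?_) (PrimrecPred.forall_finite fun u => ?_)))
  · exact (primrec_entry hσ v).pair ((Primrec.const 0).pair (primrec_entry hτ v))
  · exact (primrec_entry hσ w).pair ((Primrec.const 1).pair (primrec_entry hτ w))
  · by_cases h : u ≠ v ∧ u ≠ w
    · exact (Primrec.eq.comp (primrec_entry hτ u) (primrec_entry hσ u)).of_eq
        fun b => by simp [h]
    · exact (PrimrecPred.const True).of_eq fun b => by
        simp only [true_iff]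
        exact fun h1 h2 => absurd ⟨h1, h2⟩ h

theorem primrecPred_step (G : Topology) (hc : Primrec c) (hσ : Primrec σ)
    (hτ : Primrec τ) : PrimrecPred fun b => Step G (c b) (σ b) (τ b) :=
  (PrimrecPred.exists_finite fun v => primrecPred_intMove v hc hσ hτ).or
    (PrimrecPred.exists_finite fun v => PrimrecPred.exists_finite fun w =>
      primrecPred_tokMove v w hc hσ hτ)

theorem primrecPred_pathStep (κ : PathConvention) (G : Topology) (hc : Primrec c)
    (hσ : Primrec σ) (hτ : Primrec τ) :
    PrimrecPred fun b => PathStep κ G (c b) (σ b) (τ b) :=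
  (primrecPred_step G hc hσ hτ).or ((PrimrecPred.const _).and
    ((PrimrecPred.forall_mem_comp ((primrec_nodes _).comp hc)
      (primrecPred_step G (hc.comp Primrec.fst) (hσ.comp Primrec.fst) Primrec.snd).not).and
        (Primrec.eq.comp hτ hσ)))

theorem primrec_edges (κ : PathConvention) (G : Topology) : Primrec (edges κ G) := by
  classical
  refine Primrec.filter_comp (Primrec.list_flatMap (primrec_nodes _)
    (Primrec.list_map ((primrec_nodes _).comp Primrec.fst)
      ((Primrec.snd.comp Primrec.fst).pair Primrec.snd))) ?_
  exact primrecPred_pathStep κ G Primrec.fst (Primrec.fst.comp Primrec.snd)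
    (Primrec.snd.comp Primrec.snd)

theorem primrec_atoms {n m : ℕ} (g : Fin n → Fin m) : Primrec (atoms g) := by
  refine Primrec.filter_comp (Primrec.list_flatMap (primrec_nodes _) (Primrec.list_flatMap
    (primrec_label.comp Primrec.fst) (Primrec.list_map (Primrec.const _) ?_)))
    (PrimrecPred.mem_comp (primrec_label.comp Primrec.fst) ?_)
  · exact (Primrec.snd.comp (Primrec.fst.comp Primrec.fst)).pair
      ((Primrec.snd.comp (Primrec.snd.comp Primrec.fst)).pair Primrec.snd)
  · exact ((Primrec.list_getD 0).comp (Primrec.fst.comp Primrec.snd)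
      ((Primrec.list_getD 0).comp (Primrec.const _)
        (Primrec.snd.comp (Primrec.snd.comp Primrec.snd)))).pair
      (Primrec.fst.comp (Primrec.snd.comp Primrec.snd))

theorem primrec_start (G : Topology) : Primrec (start G) := by
  refine Primrec.list_ofFn fun v => ?_
  split_ifs
  · exact primrec_initTok
  · exact primrec_initNon

end Primrec

section Correct

variable {c : TemplateCode} {P : ProcessTemplate} {e : P.State ≃ Fin c.states} {m : ℕ}

/-- Code of a global state. -/
def encodeState (e : P.State ≃ Fin c.states) (s : Fin m → P.State) : List ℕ :=
  List.ofFn fun v => (e (s v) : ℕ)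

theorem getD_ofFn {k : ℕ} (f : Fin k → ℕ) (v : Fin k) : (List.ofFn f).getD v 0 = f v := by
  simp [List.getD]

theorem encodeState_getD (s : Fin m → P.State) (v : Fin m) :
    (encodeState e s).getD v 0 = e (s v) :=
  getD_ofFn _ v

theorem encodeState_injective :
    Function.Injective (encodeState e : (Fin m → P.State) → List ℕ) := by
  intro s t h
  funext v
  have := congrArg (fun l => l.getD (v : ℕ) 0) h
  simp only [encodeState_getD] at this
  exact e.injective (Fin.ext this)

theorem mem_nodes_iff {σ : List ℕ} : σ ∈ c.nodes m ↔ ∃ s : Fin m → P.State, encodeState e s = σ := by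
  simp only [nodes, List.mem_filter, mem_listsUpTo, List.mem_range, decide_eq_true_eq]
  constructor
  · rintro ⟨⟨-, h⟩, rfl⟩
    refine ⟨fun v => e.symm ⟨σ.get v, h _ (σ.get_mem v)⟩, ?_⟩
    simp [encodeState]
  · rintro ⟨s, rfl⟩
    simp only [encodeState, List.length_ofFn, le_refl, true_and, and_true, List.mem_ofFn]
    rintro _ ⟨v, rfl⟩
    exact (e (s v)).2

variable {a : P.Act ≃ Fin c.acts} {G : Topology} {s t : Fin G.size → P.State}

theorem intMove_iff
    (htr : ∀ q l q', P.tr q l q' ↔ ((e q : ℕ), l.number a, (e q' : ℕ)) ∈ c.tr) {v : Fin G.size} :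
    IntMove v c (encodeState e s) (encodeState e t) ↔ _root_.IntMove P v s t := by
  simp only [IntMove, _root_.IntMove, encodeState_getD, List.mem_range, Fin.val_inj,
    e.apply_eq_iff_eq]
  refine and_congr_left fun _ => ⟨?_, ?_⟩
  · rintro ⟨b, hb, h⟩
    refine ⟨a.symm ⟨b, hb⟩, (htr _ _ _).2 ?_⟩
    simpa [ProcLabel.number] using h
  · rintro ⟨b, h⟩
    exact ⟨a b, (a b).2, (htr _ _ _).1 h⟩

theorem step_iff
    (htr : ∀ q l q', P.tr q l q' ↔ ((e q : ℕ), l.number a, (e q' : ℕ)) ∈ c.tr) :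
    Step G c (encodeState e s) (encodeState e t) ↔ (tokenSystem P G).Step s t := by
  rw [tokenSystem_step_iff, Step]
  refine or_congr (exists_congr fun v => intMove_iff htr)
    (exists_congr fun v => exists_congr fun w => ?_)
  simp only [TokMove, _root_.TokMove, encodeState_getD, htr, ProcLabel.number, Fin.val_inj,
    e.apply_eq_iff_eq]

theorem pathStep_iff {κ : PathConvention}
    (htr : ∀ q l q', P.tr q l q' ↔ ((e q : ℕ), l.number a, (e q' : ℕ)) ∈ c.tr) :
    PathStep κ G c (encodeState e s) (encodeState e t) ↔ (tokenSystem P G).PathStep κ s t := by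
  show _ ↔ (tokenSystem P G).Step s t ∨
    (κ = .maximal ∧ (∀ u, ¬ (tokenSystem P G).Step s u) ∧ t = s)
  rw [PathStep, step_iff htr, encodeState_injective.eq_iff]
  refine or_congr_right (and_congr_right fun _ => and_congr_left fun _ => ⟨?_, ?_⟩)
  · intro h u hu
    exact h _ (mem_nodes_iff.2 ⟨u, rfl⟩) ((step_iff htr).2 hu)
  · intro h υ hυ hstep
    obtain ⟨u, rfl⟩ := (mem_nodes_iff (e := e)).1 hυ
    exact h u ((step_iff htr).1 hstep)

theorem mem_edges_iff {κ : PathConvention} {σ τ : List ℕ} :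
    (σ, τ) ∈ c.edges κ G ↔
      (σ ∈ c.nodes G.size ∧ τ ∈ c.nodes G.size) ∧ PathStep κ G c σ τ := by
  simp only [edges, List.mem_filter, List.mem_flatMap, List.mem_map, Prod.mk.injEq,
    decide_eq_true_eq]
  refine and_congr_left fun _ => ⟨?_, ?_⟩
  · rintro ⟨_, h1, _, h2, rfl, rfl⟩
    exact ⟨h1, h2⟩
  · rintro ⟨h1, h2⟩
    exact ⟨σ, h1, τ, h2, rfl, rfl⟩

theorem mem_atoms_iff {n : ℕ} {g : Fin n → Fin m} {s : Fin m → P.State}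
    (hlab : ∀ q p, p ∈ P.label q ↔ ((e q : ℕ), p) ∈ c.label) {p : ℕ} {x : Fin n} :
    (encodeState e s, p, (x : ℕ)) ∈ c.atoms g ↔ p ∈ P.label (s (g x)) := by
  simp only [atoms, List.mem_filter, decide_eq_true_eq]
  rw [getD_ofFn, encodeState_getD, hlab]
  refine and_iff_right_of_imp fun h => ?_
  simp only [List.mem_flatMap, List.mem_map, List.mem_range]
  exact ⟨_, mem_nodes_iff.2 ⟨s, rfl⟩, _, h, x, x.2, rfl⟩

theorem isPathEmbedding_encodeState {κ : PathConvention} {n : ℕ} {g : Fin n → Fin G.size}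
    (htr : ∀ q l q', P.tr q l q' ↔ ((e q : ℕ), l.number a, (e q' : ℕ)) ∈ c.tr)
    (hlab : ∀ q p, p ∈ P.label q ↔ ((e q : ℕ), p) ∈ c.label) :
    IsPathEmbedding κ (observedSystem P G g) (listLTS n (c.edges κ G) (c.atoms g))
      (encodeState e) where
  injective := encodeState_injective
  label_eq s := Set.ext fun x => (mem_atoms_iff hlab).symm
  step_iff s t := (exists_const Unit).trans (mem_edges_iff.trans
    ((and_iff_right ⟨mem_nodes_iff.2 ⟨s, rfl⟩, mem_nodes_iff.2 ⟨t, rfl⟩⟩).trans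
      (pathStep_iff htr)))
  closed s y := by
    rintro ⟨_, h⟩
    exact mem_nodes_iff.1 (mem_edges_iff.1 h).1.2

/-- The model checker decides the truth of a state formula in a token-passing system. -/
theorem modelCheck_start_iff {κ : PathConvention} {n : ℕ} (g : Fin n → Fin G.size)
    (hc : c.Represents P) (φ : StateFormula (ℕ × Fin n)) :
    modelCheck (c.nodes G.size) (c.edges κ G) (c.atoms g) (c.start G) φ.code = true ↔
      (observedSystem P G g).Models κ φ := by
  obtain ⟨e, a, -, hi, hi', htr, hlab⟩ := hc
  have hstart : c.start G =
      encodeState e fun v : Fin G.size => if v = G.start then P.initTok else P.initNon := by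
    rw [start, encodeState]
    congr 1
    funext v
    split_ifs
    · exact hi.symm
    · exact hi'.symm
  rw [hstart, modelCheck_iff (fun x hx => (mem_edges_iff.1 hx).1.1) (mem_nodes_iff.2 ⟨_, rfl⟩)]
  refine (StateFormula.sat_iff_of_isPathEmbedding
    (isPathEmbedding_encodeState (κ := κ) (g := g) htr hlab) φ _).symm.trans ?_
  constructor
  · rintro h s rfl
    exact h
  · intro h
    exact h _ rfl

end Correct

end TemplateCode

/-! ## Decidability -/

theorem IndexRange.code_injective {n : ℕ} :
    Function.Injective (IndexRange.code : IndexRange n → ℕ) := by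
  rintro (_ | Y | y) (_ | Y' | y') h <;>
    simp only [IndexRange.code, Nat.pair_eq_pair] at h <;> try omega
  · rfl
  · have h2 : ∑ i ∈ Y.map Fin.valEmbedding, 2 ^ i = ∑ i ∈ Y'.map Fin.valEmbedding, 2 ^ i := by
      simpa using h.2
    rw [Finset.map_injective _ (Finset.geomSum_injective le_rfl h2)]
  · rw [Fin.ext h.2]

theorem exists_primrecPred_holds (κ : PathConvention) (G : Topology) (k n : ℕ)
    (g : Fin n → Fin G.size) :
    ∃ p : TemplateCode × ℕ → Prop, PrimrecPred p ∧
      ∀ (P : ProcessTemplate) (c : TemplateCode), c.Represents P → ∀ Φ : Prenex n k,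
        (p (c, Φ.code) ↔ Φ.Holds κ P G g) := by
  induction k generalizing n with
  | zero =>
    refine ⟨fun q => modelCheck (q.1.nodes G.size) (q.1.edges κ G) (q.1.atoms g) (q.1.start G)
      q.2.unpair.2 = true, ?_, fun P c hc Φ => ?_⟩
    · exact Primrec.eq.comp (primrec_modelCheck_comp
        ((TemplateCode.primrec_nodes _).comp Primrec.fst)
        ((TemplateCode.primrec_edges κ G).comp Primrec.fst)
        ((TemplateCode.primrec_atoms g).comp Primrec.fst)
        ((TemplateCode.primrec_start G).comp Primrec.fst)
        (Primrec.snd.comp (Primrec.unpair.comp Primrec.snd))) (Primrec.const true)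
    · cases Φ with
      | matrix φ =>
        simp only [Prenex.code, Nat.unpair_pair]
        exact TemplateCode.modelCheck_start_iff g hc φ
  | succ k ih =>
    choose p hp hpP using fun v => ih (n + 1) (Fin.snoc g v)
    have hfin : ∀ v, {x | ∃ r : IndexRange n, r.Mem G g v ∧ r.code = x}.Finite :=
      fun v => (Set.toFinite {r : IndexRange n | r.Mem G g v}).image IndexRange.code
    have hmem : ∀ v (r : IndexRange n), r.code ∈ (hfin v).toFinset.toList ↔ r.Mem G g v := by
      intro v r
      rw [Finset.mem_toList, Set.Finite.mem_toFinset]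
      exact ⟨fun ⟨r', h1, h2⟩ => IndexRange.code_injective h2 ▸ h1, fun h => ⟨r, h, rfl⟩⟩
    have hx : Primrec fun q : TemplateCode × ℕ => q.2.unpair.2.unpair :=
      Primrec.unpair.comp (Primrec.snd.comp (Primrec.unpair.comp Primrec.snd))
    have hr : ∀ v, PrimrecPred fun q : TemplateCode × ℕ =>
        q.2.unpair.2.unpair.1 ∈ (hfin v).toFinset.toList :=
      fun v => PrimrecPred.mem_comp (Primrec.const _) (Primrec.fst.comp hx)
    have hq : ∀ v, PrimrecPred fun q : TemplateCode × ℕ => p v (q.1, q.2.unpair.2.unpair.2) :=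
      fun v => (hp v).comp (Primrec.fst.pair (Primrec.snd.comp hx))
    have htag : PrimrecPred fun q : TemplateCode × ℕ => q.2.unpair.1 = 2 :=
      Primrec.eq.comp (Primrec.fst.comp (Primrec.unpair.comp Primrec.snd)) (Primrec.const 2)
    refine ⟨fun q => (q.2.unpair.1 = 2 ∧ ∀ v, ¬ q.2.unpair.2.unpair.1 ∈ (hfin v).toFinset.toList ∨
        p v (q.1, q.2.unpair.2.unpair.2)) ∨
      (¬ q.2.unpair.1 = 2 ∧ ∃ v, q.2.unpair.2.unpair.1 ∈ (hfin v).toFinset.toList ∧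
        p v (q.1, q.2.unpair.2.unpair.2)),
      (htag.and (PrimrecPred.forall_finite fun v => (hr v).not.or (hq v))).or
        (htag.not.and (PrimrecPred.exists_finite fun v => (hr v).and (hq v))),
      fun P c hc Φ => ?_⟩
    cases Φ with
    | all r Φ =>
      simp only [Prenex.code, Nat.unpair_pair, hmem, hpP _ P c hc, Prenex.Holds]
      simp [imp_iff_not_or]
    | ex r Φ =>
      simp only [Prenex.code, Nat.unpair_pair, hmem, hpP _ P c hc, Prenex.Holds]
      simp

theorem Topology.finite_size_le (c : ℕ) : {G : Topology | G.size ≤ c}.Finite := by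
  classical
  refine (Set.finite_range fun t : (Σ m : Fin (c + 1), (Fin m → Fin m → Prop) × Fin m) =>
    if h : ∀ v, ¬ t.2.1 v v then some (Topology.mk t.1 t.2.1 t.2.2 h) else none).preimage
      (Option.some_injective _).injOn |>.subset ?_
  rintro ⟨m, E, s, h⟩ hm
  exact ⟨⟨⟨m, Nat.lt_succ_of_le hm⟩, E, s⟩, dif_pos h⟩

theorem pmcpDecidable_of_isCutoff {κ : PathConvention} {𝒢 : Set Topology} {k c : ℕ}
    {F : Set (Prenex 0 k)} (h : IsCutoff κ 𝒢 F c) : PMCPDecidable κ 𝒢 F := by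
  choose p hp hpP using fun G => exists_primrecPred_holds κ G k 0 Fin.elim0
  have hfin : {G | G ∈ 𝒢 ∧ G.size ≤ c}.Finite :=
    (Topology.finite_size_le c).subset fun G hG => hG.2
  obtain ⟨hdec, hall⟩ := PrimrecPred.forall_mem_finite hfin hp
  refine ⟨fun t x => decide (∀ G ∈ {G | G ∈ 𝒢 ∧ G.size ≤ c}, p G (t, x)), hall.to_comp,
    fun P t ht Φ hΦ => ?_⟩
  rw [decide_eq_true_eq, ← h P Φ hΦ]
  constructor
  · intro hG G hG' hle
    exact (hpP G P t ht Φ).1 (hG G ⟨hG', hle⟩)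
  · intro hG G hG'
    exact (hpP G P t ht Φ).2 (hG G hG'.1 hG'.2)

theorem mainTheorem1 (κ : PathConvention) (𝒢 : Set Topology) (k d : ℕ) :
    (∃ c : ℕ, IsCutoff κ 𝒢 (boundedDepth k d) c) ∧
      PMCPDecidable κ 𝒢 (boundedDepth k d) := by
  obtain ⟨c, hc⟩ := exists_isCutoff κ 𝒢 k d
  exact ⟨⟨c, hc⟩, pmcpDecidable_of_isCutoff hc⟩
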